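/- Let $(X,Y)$ be a random couple of square-integrable real random variables, and write $\tilde X=X-\mathbb E X$, $\tilde Y=Y-\mathbb E Y$, $\sigma_X^2=\operatorname{Var}(X)$, $\sigma_Y^2=\operatorname{Var}(Y)$, $\tau=\operatorname{Cov}(Y,X)/\operatorname{Var}(X)$, $\varepsilon=\tilde Y-\tau\tilde X$, $\sigma_\varepsilon^2=\operatorname{Var}(\varepsilon)$, $\|Z\|_p=(\mathbb E|Z|^p)^{1/p}$. Assume that $\tilde X\varepsilon$ is not almost surely $0$ (equivalently, that none of $\tilde X$, $\tilde X\varepsilon$, $\tilde X\tilde Y$ is almost surely $0$). Let $c_1,c_2\ge 0$ be numerical constants for which Rosenthal's inequality $$\Big\|\frac1n\sum_{i=1}^n Z_i\Big\|_q\le c_1\sqrt q\,\sqrt{\frac{\operatorname{Var}(Z_1)}{n}}+\frac{c_2\,q}{n^{(q-1)/q}}\|Z_1\|_q$$ holds with $q=4$ for all $n\ge1$ and all i.i.d. centered $Z_1,\dots,Z_n$ in $L^4$ (such constants exist; in particular one may take constants for which the inequality holds for every $q\ge2$). Define, with values in $[0,\infty]$, $$\begin{aligned}G_1={}&\frac{64\|\tilde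 Y^2\tilde X\|_1\sigma_X}{\|\tilde X\varepsilon\|_2^2}+\frac{1120\|\tilde X\|_3^3\sigma_Y^2}{\|\tilde X\varepsilon\|_2^2\sigma_X}+\frac{64\sqrt2\|\tilde X\varepsilon\|_3^3}{\|\tilde X\varepsilon\|_2^3}+\frac{288\sigma_Y\|\tilde X^2\tilde Y\|_1}{\|\tilde X\varepsilon\|_2^2}+\frac{432|\tau|\|\tilde X\|_3^3\sigma_Y}{\|\tilde X\varepsilon\|_2^2}\\&+\frac{1152\|\tilde X^3\tilde Y\|_1}{\sigma_X^2\|\tilde X\varepsilon\|_2}+\frac{1152\|\tilde X\|_4^4\sigma_Y}{\sigma_X^3\|\tilde X\varepsilon\|_2}+\frac{576|\tau|\|\tilde X\|_4^4}{\sigma_X^2\|\tilde X\varepsilon\|_2}+\frac{576\|\tilde X^2\tilde Y\|_1\sigma_Y}{\|\tilde X\varepsilon\|_2^2\sigma_X}+\frac{2\|\tilde X^2\tilde Y\|_2}{\|\tilde X^2\tilde Y\|_1}\\&+\frac{2\|\tilde Y^2\tilde X\|_2+\sigma_X\|\tilde Y\|_4^2+4\sigma_Y\|\tilde X\tilde Y\|_2}{2\|\tilde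 Y^2\tilde X\|_1}+\frac{\sigma_Y\|\tilde X\|_4^2}{\|\tilde X^2\tilde Y\|_1}+\frac{13\sigma_X\|\tilde X\|_4^2}{4\|\tilde X\|_3^3}+\frac{9\|\tilde X\|_6^3}{2\|\tilde X\|_3^3}+\frac{6\|\tilde Y\|_4^2}{\sigma_Y^2}+\frac{16\|\tilde X\|_4^2}{\sigma_X^2}\\&+\frac{2^{7/2}\|\tilde X^3\tilde Y\|_{3/2}^{3/2}}{\|\tilde X^3\tilde Y\|_1^{3/2}}+\frac{\sigma_Y\|\tilde X\|_6^3}{2\|\tilde X^3\tilde Y\|_1}+\frac{8\|\tilde X\|_6^6}{\|\tilde X\|_4^6}+\frac{\sigma_X\|\tilde X\|_6^3}{2\|\tilde X\|_4^4},\end{aligned}$$ $$G_2=4+\frac{288\|\tilde X^3\tilde Y\|_1\sigma_\varepsilon}{\sigma_X\|\tilde X\varepsilon\|_2^2}+\frac{288\sigma_Y\sigma_\varepsilon\|\tilde X\|_4^4}{\|\tilde X\varepsilon\|_2^2\sigma_X^2}+\frac{144|\tau|\sigma_\varepsilon\|\tilde X\|_4^4}{\sigma_X\|\tilde X\varepsilon\|_2^2}+\frac{c_1^2\sigma_X^3}{\|\tilde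 X\|_3^3}+\frac{2c_1^2\sigma_X\sigma_Y^2}{\|\tilde Y^2\tilde X\|_1},$$ $$G_3=16c_2^2\left[\frac{\sigma_X\|\tilde X\|_4^2}{\|\tilde X\|_3^3}+\frac{2\sigma_X\|\tilde Y\|_4^2}{\|\tilde Y^2\tilde X\|_1}\right],$$ where a quotient $\infty/\infty$ is read as $0$. These three quantities are finite as soon as $X$ and $Y$ have finite moments of order $6$. Moreover, let $n\ge1$, let $(X_1,Y_1),\dots,(X_n,Y_n)$ be independent copies of $(X,Y)$, let $\bar X,\bar Y$ be the empirical means, and put $$\hat\tau=\frac{\sum_i(X_i-\bar X)(Y_i-\bar Y)}{\sum_i(X_i-\bar X)^2},\qquad \hat b=\bar Y-\hat\tau\bar X,\qquad \hat\varepsilon_i=Y_i-\hat b-\hat\tau X_i$$ (with $\hat\tau=0$ if all the $X_i$ coincide). Then $$\mathbb P\left(\left|\frac1n\sum_{i=1}^n(X_i-\bar X)^2\hat\varepsilon_i^2-\|\tilde X\varepsilon\|_2^2\right|\ge\frac{\|\tilde X\varepsilon\|_2^2}{2}\right)\le\frac{G_1}{\sqrt n}+\frac{4G_2}{n}+\frac{G_3}{n^{3/2}}$$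 (the right-hand side being $+\infty$, and the claim empty, if $\|\tilde X\varepsilon\|_2=\infty$). -/

import Mathlib

open MeasureTheory ProbabilityTheory
open scoped ENNReal NNReal

noncomputable section

namespace Slope

/-! ### Population quantities for a random couple `(X, Y)` under `P` -/

section Population

variable {Ω : Type*} [MeasurableSpace Ω]

/-- The centred variable `X - E(X)`. -/
def centered (X : Ω → ℝ) (P : Measure Ω) : Ω → ℝ := fun ω => X ω - ∫ ω', X ω' ∂P

/-- The standard deviation `√Var(X)`, as an extended nonnegative number
(used only for `X` in `L²`). -/
def stdDev (X : Ω → ℝ) (P : Measure Ω) : ℝ≥0∞ := ENNReal.ofReal (√(Var[X; P]))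

/-- The slope `τ = Cov(Y, X) / Var(X)`. -/
def slope (X Y : Ω → ℝ) (P : Measure Ω) : ℝ := cov[Y, X; P] / Var[X; P]

/-- The error `ε = (Y - E(Y)) - τ (X - E(X))`. -/
def regError (X Y : Ω → ℝ) (P : Measure Ω) : Ω → ℝ :=
  fun ω => centered Y P ω - slope X Y P * centered X P ω

/-! The three moment ratios take values in `[0, ∞]`. In the formulas, `N p f` is the norm
`‖f‖_p` under `P`, and `x`, `y`, `e` are the variables `X - E(X)`, `Y - E(Y)`, `ε`. -/

/-- The ratio `G₁(X, Y)`. -/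
def G1 (X Y : Ω → ℝ) (P : Measure Ω) : ℝ≥0∞ :=
  let N : ℝ≥0∞ → (Ω → ℝ) → ℝ≥0∞ := fun p f => eLpNorm f p P
  let x := centered X P
  let y := centered Y P
  let e := regError X Y P
  let σX := stdDev X P
  let σY := stdDev Y P
  let τ : ℝ≥0∞ := ENNReal.ofReal |slope X Y P|
  64 * N 1 (y ^ 2 * x) * σX / N 2 (x * e) ^ 2
  + 1120 * N 3 x ^ 3 * σY ^ 2 / (N 2 (x * e) ^ 2 * σX)
  + 64 * 2 ^ (1 / 2 : ℝ) * N 3 (x * e) ^ 3 / N 2 (x * e) ^ 3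
  + 288 * σY * N 1 (x ^ 2 * y) / N 2 (x * e) ^ 2
  + 432 * τ * N 3 x ^ 3 * σY / N 2 (x * e) ^ 2
  + 1152 * N 1 (x ^ 3 * y) / (σX ^ 2 * N 2 (x * e))
  + 1152 * N 4 x ^ 4 * σY / (σX ^ 3 * N 2 (x * e))
  + 576 * τ * N 4 x ^ 4 / (σX ^ 2 * N 2 (x * e))
  + 576 * N 1 (x ^ 2 * y) * σY / (N 2 (x * e) ^ 2 * σX)
  + 2 * N 2 (x ^ 2 * y) / N 1 (x ^ 2 * y)
  + (2 * N 2 (y ^ 2 * x) + σX * N 4 y ^ 2 + 4 * σY * N 2 (x * y)) / (2 * N 1 (y ^ 2 * x))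
  + σY * N 4 x ^ 2 / N 1 (x ^ 2 * y)
  + 13 * σX * N 4 x ^ 2 / (4 * N 3 x ^ 3)
  + 9 * N 6 x ^ 3 / (2 * N 3 x ^ 3)
  + 6 * N 4 y ^ 2 / σY ^ 2
  + 16 * N 4 x ^ 2 / σX ^ 2
  + 2 ^ (7 / 2 : ℝ) * N (3 / 2) (x ^ 3 * y) ^ (3 / 2 : ℝ) / N 1 (x ^ 3 * y) ^ (3 / 2 : ℝ)
  + σY * N 6 x ^ 3 / (2 * N 1 (x ^ 3 * y))
  + 8 * N 6 x ^ 6 / N 4 x ^ 6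
  + σX * N 6 x ^ 3 / (2 * N 4 x ^ 4)

/-- The ratio `G₂(X, Y)`, for the constant `c₁` of Rosenthal's inequality. -/
def G2 (c₁ : ℝ≥0) (X Y : Ω → ℝ) (P : Measure Ω) : ℝ≥0∞ :=
  let N : ℝ≥0∞ → (Ω → ℝ) → ℝ≥0∞ := fun p f => eLpNorm f p P
  let x := centered X P
  let y := centered Y P
  let e := regError X Y P
  let σX := stdDev X P
  let σY := stdDev Y P
  let σe := stdDev e P
  let τ : ℝ≥0∞ := ENNReal.ofReal |slope X Y P|
  4
  + 288 * N 1 (x ^ 3 * y) * σe / (σX * N 2 (x * e) ^ 2)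
  + 288 * σY * σe * N 4 x ^ 4 / (N 2 (x * e) ^ 2 * σX ^ 2)
  + 144 * τ * σe * N 4 x ^ 4 / (σX * N 2 (x * e) ^ 2)
  + (c₁ : ℝ≥0∞) ^ 2 * σX ^ 3 / N 3 x ^ 3
  + 2 * (c₁ : ℝ≥0∞) ^ 2 * σX * σY ^ 2 / N 1 (y ^ 2 * x)

/-- The ratio `G₃(X, Y)`, for the constant `c₂` of Rosenthal's inequality. -/
def G3 (c₂ : ℝ≥0) (X Y : Ω → ℝ) (P : Measure Ω) : ℝ≥0∞ :=
  let N : ℝ≥0∞ → (Ω → ℝ) → ℝ≥0∞ := fun p f => eLpNorm f p P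
  let x := centered X P
  let y := centered Y P
  let σX := stdDev X P
  16 * (c₂ : ℝ≥0∞) ^ 2 *
    (σX * N 4 x ^ 2 / N 3 x ^ 3 + 2 * σX * N 4 y ^ 2 / N 1 (y ^ 2 * x))

end Population

/-! ### Empirical quantities for a sample `(x₁, y₁), …, (xₙ, yₙ)` -/

section Sample

variable {n : ℕ}

/-- The empirical mean. -/
def sampleMean (x : Fin n → ℝ) : ℝ := (∑ i, x i) / n

/-- The least squares slope `τ̂`. -/
def slopeHat (x y : Fin n → ℝ) : ℝ :=
  (∑ i, (x i - sampleMean x) * (y i - sampleMean y)) / ∑ i, (x i - sampleMean x) ^ 2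

/-- The least squares intercept `b̂`. -/
def interceptHat (x y : Fin n → ℝ) : ℝ := sampleMean y - slopeHat x y * sampleMean x

/-- The residual `ε̂ᵢ`. -/
def residual (x y : Fin n → ℝ) (i : Fin n) : ℝ := y i - interceptHat x y - slopeHat x y * x i

/-- The quantity `n⁻¹ ∑ (xᵢ - x̄)² ε̂ᵢ²`. -/
def residualMoment (x y : Fin n → ℝ) : ℝ :=
  (∑ i, (x i - sampleMean x) ^ 2 * residual x y i ^ 2) / n

end Sample

/-- `c₁` and `c₂` are admissible constants in Rosenthal's inequality with exponent `q`:
`‖n⁻¹ ∑ Zᵢ‖_q ≤ c₁ √q √(Var(Z₁)/n) + c₂ q n^{-(q-1)/q} ‖Z₁‖_q` for all `n ≥ 1` and all centred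
i.i.d. `Z₁, …, Zₙ` in `L^q`. -/
def RosenthalBound (c₁ c₂ q : ℝ≥0) : Prop :=
  ∀ (Ω : Type) [MeasurableSpace Ω] (P : Measure Ω) [IsProbabilityMeasure P]
    (n : ℕ) (Z : Fin n → Ω → ℝ) (i₀ : Fin n),
    iIndepFun Z P → (∀ i, IdentDistrib (Z i) (Z i₀) P P) →
    MemLp (Z i₀) q P → ∫ ω, Z i₀ ω ∂P = 0 →
    eLpNorm (fun ω => (∑ i, Z i ω) / n) q P ≤
      c₁ * (q : ℝ≥0∞) ^ (1 / 2 : ℝ) * (stdDev (Z i₀) P / (n : ℝ≥0∞) ^ (1 / 2 : ℝ))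
      + c₂ * q * (eLpNorm (Z i₀) q P / (n : ℝ≥0∞) ^ (((q : ℝ) - 1) / q))

end Slope

end

/-! The term `G1`/√n alone dominates the probability, through three of its summands; all other terms
are nonnegative and dropped.

Residuals are unaffected by translating the covariate and adding an affine function of it to the
response, so the sample can be replaced by x = X - E X and e = ε. With τ̂ the fitted slope of e on
x, the vector x·e equals (x - x̄)·ε̂ plus x̄(e - ē) + ē x + τ̂(x - x̄)². The statistic is the
squared empirical L² norm of (x - x̄)·ε̂. Hence it lies within m²/2 of m² = ‖X̃ε‖₂² once the squared
norm of x·e is within 3m²/20 of m² and the perturbation has norm below 3m/20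
(`abs_residualMoment_sub_lt`).

Put K = ‖X̃ε‖₃³/m³, q = σ_X σ_ε/m, κ = ‖X̃‖₄²/σ_X². A truncated law of large numbers controls x·e
using third moments only (`measureReal_le_sampleMean_sq_sub_le`), and Chebyshev controls the
empirical mean and second moment of x. Each part of the perturbation is bounded by an empirical mean
of x, e or x·e, centred and so of size n^{-1/2}, times an empirical norm: Cauchy–Schwarz bounds its
expectation and Markov's inequality suffices. The total is at most (90K + 1120q² + 16κ)/√n
(`measureReal_residualMoment_le`). Each of its terms is below a summand of `G1`, because 90 ≤ 64√2,
σ_X ≤ ‖X̃‖₃ and σ_ε ≤ σ_Y.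

The existence of Rosenthal constants for q = 4 is separate and follows from an exact fourth moment
expansion. -/

noncomputable section

namespace Slope

/-! ### Deterministic estimates for samples -/

/-- The empirical `L²` norm. -/
def empNorm {n : ℕ} (f : Fin n → ℝ) : ℝ := √((∑ i, f i ^ 2) / n)

theorem empNorm_nonneg {n : ℕ} (f : Fin n → ℝ) : 0 ≤ empNorm f := Real.sqrt_nonneg _

theorem empNorm_sq {n : ℕ} (f : Fin n → ℝ) : empNorm f ^ 2 = (∑ i, f i ^ 2) / n :=
  Real.sq_sqrt (by positivity)

theorem empNorm_eq_norm {n : ℕ} (f : Fin n → ℝ) : empNorm f = ‖WithLp.toLp 2 f‖ / √n := by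
  rw [empNorm, Real.sqrt_div (by positivity), EuclideanSpace.norm_eq]
  simp

theorem empNorm_add_le {n : ℕ} (f g : Fin n → ℝ) : empNorm (f + g) ≤ empNorm f + empNorm g := by
  simp only [empNorm_eq_norm, WithLp.toLp_add, ← add_div]
  gcongr
  exact norm_add_le _ _

theorem empNorm_smul {n : ℕ} (c : ℝ) (f : Fin n → ℝ) : empNorm (c • f) = |c| * empNorm f := by
  simp only [empNorm_eq_norm, WithLp.toLp_smul, norm_smul, Real.norm_eq_abs, mul_div_assoc]

theorem sum_sub_sampleMean_mul {n : ℕ} (hn : 0 < n) (x e : Fin n → ℝ) :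
    ∑ i, (x i - sampleMean x) * (e i - sampleMean e)
      = n * (sampleMean (x * e) - sampleMean x * sampleMean e) := by
  have hn' : (n : ℝ) ≠ 0 := by positivity
  have hx : ∑ i, x i = n * sampleMean x := by rw [sampleMean]; field_simp
  have he : ∑ i, e i = n * sampleMean e := by rw [sampleMean]; field_simp
  have hxe : ∑ i, x i * e i = n * sampleMean (x * e) := by rw [sampleMean]; field_simp; rfl
  have : ∀ i, (x i - sampleMean x) * (e i - sampleMean e)
      = x i * e i - sampleMean e * x i - sampleMean x * e i + sampleMean x * sampleMean e :=
    fun i => by ring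
  simp only [this, Finset.sum_add_distrib, Finset.sum_sub_distrib, ← Finset.mul_sum, hx, he, hxe,
    Finset.sum_const, Finset.card_univ, Fintype.card_fin, nsmul_eq_mul]
  ring

theorem sum_sub_sampleMean_sq {n : ℕ} (hn : 0 < n) (x : Fin n → ℝ) :
    ∑ i, (x i - sampleMean x) ^ 2 = n * (empNorm x ^ 2 - sampleMean x ^ 2) := by
  have := sum_sub_sampleMean_mul hn x x
  simp only [← sq] at this
  rw [this, empNorm_sq]
  rfl

theorem empNorm_sub_sampleMean_le {n : ℕ} (hn : 0 < n) (e : Fin n → ℝ) :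
    empNorm (fun i => e i - sampleMean e) ≤ empNorm e := by
  refine abs_le_of_sq_le_sq' ?_ (empNorm_nonneg _) |>.2
  have hn' : (n : ℝ) ≠ 0 := by positivity
  rw [empNorm_sq, sum_sub_sampleMean_sq hn, mul_div_cancel_left₀ _ hn']
  nlinarith [sq_nonneg (sampleMean e)]

theorem slopeHat_eq {n : ℕ} (hn : 0 < n) (x e : Fin n → ℝ) :
    slopeHat x e = (sampleMean (x * e) - sampleMean x * sampleMean e)
      / (empNorm x ^ 2 - sampleMean x ^ 2) := by
  have hn' : (n : ℝ) ≠ 0 := by positivity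
  rw [slopeHat, sum_sub_sampleMean_mul hn, sum_sub_sampleMean_sq hn, mul_div_mul_left _ _ hn']

theorem residual_eq {n : ℕ} (x e : Fin n → ℝ) (i : Fin n) :
    residual x e i = e i - sampleMean e - slopeHat x e * (x i - sampleMean x) := by
  rw [residual, interceptHat]; ring

theorem sampleMean_const_add_mul_add_mul {n : ℕ} (hn : 0 < n) (x e : Fin n → ℝ) (ν t s : ℝ) :
    sampleMean (fun i => ν + t * x i + s * e i) = ν + t * sampleMean x + s * sampleMean e := by
  have hn' : (n : ℝ) ≠ 0 := by positivity
  simp only [sampleMean, Finset.sum_add_distrib, ← Finset.mul_sum, Finset.sum_const,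
    Finset.card_univ, Fintype.card_fin, nsmul_eq_mul]
  field_simp

/-- Residuals do not change when the covariate is translated and an affine function of it is
added to the response. -/
theorem residualMoment_affine {n : ℕ} (hn : 0 < n) (x e : Fin n → ℝ) (c ν t : ℝ)
    (h : empNorm x ^ 2 - sampleMean x ^ 2 ≠ 0) :
    residualMoment (fun i => x i + c) (fun i => ν + t * x i + e i) = residualMoment x e := by
  have hn' : (n : ℝ) ≠ 0 := by positivity
  have h1 : sampleMean (fun i => x i + c) = sampleMean x + c := by
    have := sampleMean_const_add_mul_add_mul hn x x c 1 0
    simp only [one_mul, zero_mul, add_zero] at this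
    simpa only [add_comm] using this
  have h2 : sampleMean (fun i => ν + t * x i + e i) = ν + t * sampleMean x + sampleMean e := by
    simpa using sampleMean_const_add_mul_add_mul hn x e ν t 1
  have hd : ∑ i, (x i - sampleMean x) ^ 2 ≠ 0 := by
    rw [sum_sub_sampleMean_sq hn]; exact mul_ne_zero hn' h
  -- Nondegeneracy enters here: for a constant covariate the quotient is 0 by convention, and the
  -- fitted slope would not shift by t.
  have h3 : slopeHat (fun i => x i + c) (fun i => ν + t * x i + e i) = t + slopeHat x e := by
    simp only [slopeHat, h1, h2]
    have e1 : ∀ i, x i + c - (sampleMean x + c) = x i - sampleMean x := fun i => by ring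
    have e2 : ∀ i, (x i - sampleMean x) *
        (ν + t * x i + e i - (ν + t * sampleMean x + sampleMean e))
        = t * (x i - sampleMean x) ^ 2 + (x i - sampleMean x) * (e i - sampleMean e) :=
      fun i => by ring
    simp only [e1, e2, Finset.sum_add_distrib, ← Finset.mul_sum]
    field_simp
  simp only [residualMoment, residual_eq, h1, h2, h3]
  congr 1
  refine Finset.sum_congr rfl fun i _ => ?_
  ring

theorem residualMoment_eq_empNorm_sq {n : ℕ} (x e : Fin n → ℝ) :
    residualMoment x e = empNorm (fun i => (x i - sampleMean x) * residual x e i) ^ 2 := by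
  rw [empNorm_sq, residualMoment]
  simp only [mul_pow]

/-- Convexity of the fourth power at x - a = (8/9)(9x/8) + (1/9)(-9a), obtained by squaring twice.
The weights keep the coefficient of x⁴ below (5/4)². -/
theorem sub_pow_four_le (x a : ℝ) : (x - a) ^ 4 ≤ (9 / 8) ^ 3 * x ^ 4 + 9 ^ 3 * a ^ 4 := by
  have h : (x - a) ^ 2 ≤ 9 / 8 * x ^ 2 + 9 * a ^ 2 := by nlinarith [sq_nonneg (x + 8 * a)]
  have h2 : (x - a) ^ 4 ≤ (9 / 8 * x ^ 2 + 9 * a ^ 2) ^ 2 := by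
    calc (x - a) ^ 4 = ((x - a) ^ 2) ^ 2 := by ring
      _ ≤ _ := by gcongr
  nlinarith [sq_nonneg (x ^ 2 - 64 * a ^ 2)]

theorem empNorm_pow_four_le {n : ℕ} (hn : 0 < n) (x : Fin n → ℝ) :
    empNorm x ^ 4 ≤ empNorm (x ^ 2) ^ 2 := by
  have hn' : (0 : ℝ) < n := by positivity
  have h := sq_sum_le_card_mul_sum_sq (s := Finset.univ) (f := fun i => x i ^ 2)
  rw [show empNorm x ^ 4 = (empNorm x ^ 2) ^ 2 by ring, empNorm_sq, empNorm_sq, div_pow,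
    div_le_div_iff₀ (by positivity) (by positivity)]
  simp only [Finset.card_univ, Fintype.card_fin] at h
  simp only [Pi.pow_apply]
  nlinarith

theorem empNorm_sub_sampleMean_sq_le {n : ℕ} (hn : 0 < n) (x : Fin n → ℝ)
    (ha : 84 * sampleMean x ^ 2 ≤ empNorm x ^ 2) :
    empNorm (fun i => (x i - sampleMean x) ^ 2) ≤ 5 / 4 * empNorm (x ^ 2) := by
  have hn' : (0 : ℝ) < n := by positivity
  refine abs_le_of_sq_le_sq' ?_ (mul_nonneg (by norm_num) (empNorm_nonneg _)) |>.2
  have h1 : empNorm (fun i => (x i - sampleMean x) ^ 2) ^ 2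
      ≤ (9 / 8) ^ 3 * empNorm (x ^ 2) ^ 2 + 9 ^ 3 * sampleMean x ^ 4 := by
    rw [empNorm_sq, empNorm_sq, div_le_iff₀ hn']
    calc ∑ i, ((x i - sampleMean x) ^ 2) ^ 2
        ≤ ∑ i, ((9 / 8) ^ 3 * ((x ^ 2) i) ^ 2 + 9 ^ 3 * sampleMean x ^ 4) := by
          refine Finset.sum_le_sum fun i _ => ?_
          have := sub_pow_four_le (x i) (sampleMean x)
          simp only [Pi.pow_apply, ← pow_mul]
          exact this
      _ = _ := by
          rw [Finset.sum_add_distrib, ← Finset.mul_sum]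
          simp only [Finset.sum_const, Finset.card_univ, Fintype.card_fin, nsmul_eq_mul]
          field_simp
  have h2 := empNorm_pow_four_le hn x
  have h3 : (84 * sampleMean x ^ 2) ^ 2 ≤ (empNorm x ^ 2) ^ 2 := by gcongr
  -- The constants fit because (9/8)³ + 9³/84² < (5/4)².
  nlinarith [sq_nonneg (empNorm (x ^ 2))]

/-- Triangle inequality for the exact decomposition x·e = w + d below, in which the terms with τ̂
cancel. -/
theorem empNorm_residual_sub_le {n : ℕ} (hn : 0 < n) (x e : Fin n → ℝ) :
    |empNorm (fun i => (x i - sampleMean x) * residual x e i) - empNorm (x * e)|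
      ≤ |sampleMean x| * empNorm e + |sampleMean e| * empNorm x
        + |slopeHat x e| * empNorm (fun i => (x i - sampleMean x) ^ 2) := by
  set w : Fin n → ℝ := fun i => (x i - sampleMean x) * residual x e i
  set d : Fin n → ℝ := (sampleMean x • (fun i => e i - sampleMean e)) + sampleMean e • x
    + slopeHat x e • (fun i => (x i - sampleMean x) ^ 2) with hd
  have hw : x * e = w + d := by
    ext i
    simp only [w, d, Pi.add_apply, Pi.mul_apply, Pi.smul_apply, smul_eq_mul, residual_eq]
    ring
  have hw' : w = x * e + (-1 : ℝ) • d := by rw [hw]; ext i; simp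
  have hdn : empNorm d ≤ |sampleMean x| * empNorm e + |sampleMean e| * empNorm x
        + |slopeHat x e| * empNorm (fun i => (x i - sampleMean x) ^ 2) := by
    refine (empNorm_add_le _ _).trans ?_
    rw [empNorm_smul]
    gcongr
    refine (empNorm_add_le _ _).trans ?_
    rw [empNorm_smul, empNorm_smul]
    gcongr
    exact empNorm_sub_sampleMean_le hn e
  have h1 : empNorm (x * e) ≤ empNorm w + empNorm d := by
    rw [hw]; exact empNorm_add_le _ _
  have h2 : empNorm w ≤ empNorm (x * e) + empNorm d := by
    have := empNorm_add_le (x * e) ((-1 : ℝ) • d)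
    rwa [← hw', empNorm_smul, abs_neg, abs_one, one_mul] at this
  rw [abs_le]
  constructor <;> linarith

theorem abs_residualMoment_sub_lt {n : ℕ} (hn : 0 < n) (x e : Fin n → ℝ) {m σ ρ : ℝ}
    (hm : 0 < m) (hσ : 0 < σ) (hρ : 106 * ρ ^ 2 ≤ 1)
    (hA : |empNorm (x * e) ^ 2 - m ^ 2| < 3 / 20 * m ^ 2)
    (hS : 4 / 5 * σ ^ 2 < empNorm x ^ 2) (ha : |sampleMean x| < σ * ρ)
    (hT : |sampleMean x| * empNorm e + |sampleMean e| * empNorm x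
      + 5 / 3 * (|sampleMean (x * e)| + σ * ρ * |sampleMean e|) * empNorm (x ^ 2) / σ ^ 2
        < 3 / 20 * m) :
    0 < empNorm x ^ 2 - sampleMean x ^ 2 ∧ |residualMoment x e - m ^ 2| < m ^ 2 / 2 := by
  have ha2 : sampleMean x ^ 2 ≤ (σ * ρ) ^ 2 := by
    rw [← sq_abs]; gcongr
  -- The value 106 serves twice: 4/5 - 1/106 ≥ 3/4 bounds the denominator of the slope, and 84/106 ≤
  -- 4/5 allows the bound on the norm of (x - x̄)².
  have ha3 : 106 * sampleMean x ^ 2 ≤ σ ^ 2 := by nlinarith [sq_nonneg σ]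
  have hden : 3 / 4 * σ ^ 2 ≤ empNorm x ^ 2 - sampleMean x ^ 2 := by nlinarith [sq_nonneg σ]
  have hσ2 : 0 < σ ^ 2 := by positivity
  refine ⟨by linarith, ?_⟩
  have hv : empNorm (fun i => (x i - sampleMean x) ^ 2) ≤ 5 / 4 * empNorm (x ^ 2) :=
    empNorm_sub_sampleMean_sq_le hn x (by linarith)
  have hslope : |slopeHat x e|
      ≤ (|sampleMean (x * e)| + σ * ρ * |sampleMean e|) / (3 / 4 * σ ^ 2) := by
    rw [slopeHat_eq hn, abs_div, abs_of_pos (by linarith : 0 < empNorm x ^ 2 - sampleMean x ^ 2)]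
    gcongr
    · have : 0 ≤ σ * ρ := (abs_nonneg _).trans ha.le
      positivity
    · refine (abs_sub _ _).trans ?_
      rw [abs_mul]
      gcongr
  have hd := empNorm_residual_sub_le hn x e
  -- The factor 5/3 is (5/4)/(3/4).
  have hlast : |slopeHat x e| * empNorm (fun i => (x i - sampleMean x) ^ 2)
      ≤ 5 / 3 * (|sampleMean (x * e)| + σ * ρ * |sampleMean e|) * empNorm (x ^ 2) / σ ^ 2 := by
    refine (mul_le_mul hslope hv (empNorm_nonneg _) ((abs_nonneg _).trans hslope)).trans_eq ?_
    field_simp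
  rw [residualMoment_eq_empNorm_sq]
  set w := empNorm (fun i => (x i - sampleMean x) * residual x e i)
  set A := empNorm (x * e) with hAdef
  have hw0 : 0 ≤ w := empNorm_nonneg _
  have hA0 : 0 ≤ A := empNorm_nonneg _
  have hwA : |w - A| < 3 / 20 * m := by linarith
  rw [abs_lt] at hA hwA
  -- Margins: 1.073² > 1.15 and 0.9² < 0.85 locate A; moving by 0.15 m leaves w between 0.75 m and
  -- 1.223 m, whose squares lie within m²/2 of m².
  have hA1 : A < 1073 / 1000 * m := by
    by_contra! h
    have : (1073 / 1000 * m) ^ 2 ≤ A ^ 2 := by gcongr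
    nlinarith
  have hA2 : 9 / 10 * m < A := by
    by_contra! h
    have : A ^ 2 ≤ (9 / 10 * m) ^ 2 := by gcongr
    nlinarith
  have hw1 : w < 1223 / 1000 * m := by linarith
  have hw2 : 3 / 4 * m < w := by linarith
  have hw3 : w ^ 2 < (1223 / 1000 * m) ^ 2 := by gcongr
  have hw4 : (3 / 4 * m) ^ 2 < w ^ 2 := by gcongr
  rw [abs_lt]
  constructor <;> nlinarith [sq_pos_of_pos hm]

/-! ### Moment and tail bounds for empirical means -/

section Tails

variable {Ω : Type*} [MeasurableSpace Ω] {μ : Measure Ω}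

theorem memLp_sampleMean {n : ℕ} {p : ℝ≥0∞} {Z : Fin n → Ω → ℝ} (hZ : ∀ i, MemLp (Z i) p μ) :
    MemLp (fun ω => sampleMean fun i => Z i ω) p μ := by
  have := (memLp_finsetSum Finset.univ fun i _ => hZ i).const_mul ((n : ℝ)⁻¹)
  simpa only [sampleMean, div_eq_inv_mul] using this

theorem integral_sampleMean {n : ℕ} {Z : Fin n → Ω → ℝ} {v : ℝ} (hn : 0 < n)
    (hZ : ∀ i, Integrable (Z i) μ) (h : ∀ i, ∫ ω, Z i ω ∂μ = v) :
    ∫ ω, sampleMean (fun i => Z i ω) ∂μ = v := by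
  have hn' : (n : ℝ) ≠ 0 := by positivity
  simp only [sampleMean]
  rw [integral_div, integral_finsetSum _ fun i _ => hZ i]
  simp only [h, Finset.sum_const, Finset.card_univ, Fintype.card_fin, nsmul_eq_mul]
  field_simp

theorem integral_sampleMean_sq_le [IsProbabilityMeasure μ] {n : ℕ} {Z : Fin n → Ω → ℝ}
    {v : ℝ} (hn : 0 < n) (hind : iIndepFun Z μ) (hZ : ∀ i, MemLp (Z i) 2 μ) (h0 : ∀ i, ∫ ω, Z i ω ∂μ = 0)
    (hv : ∀ i, ∫ ω, Z i ω ^ 2 ∂μ ≤ v) :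
    ∫ ω, sampleMean (fun i => Z i ω) ^ 2 ∂μ ≤ v / n := by
  have hn' : (0 : ℝ) < n := by positivity
  have hsum : MemLp (∑ i, Z i) 2 μ := memLp_finsetSum' _ fun i _ => hZ i
  have hint : ∫ ω, (∑ i, Z i) ω ∂μ = 0 := by
    simp only [Finset.sum_apply]
    rw [integral_finsetSum _ fun i _ => (hZ i).integrable one_le_two]
    simp [h0]
  have hvar := IndepFun.variance_sum (s := Finset.univ) (fun i _ => hZ i)
    (fun i _ j _ hij => hind.indepFun hij)
  rw [variance_of_integral_eq_zero hsum.aemeasurable hint] at hvar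
  have hle : ∫ ω, (∑ i, Z i) ω ^ 2 ∂μ ≤ n * v := by
    rw [hvar]
    calc ∑ i, Var[Z i; μ] ≤ ∑ _i : Fin n, v := by
          refine Finset.sum_le_sum fun i _ => ?_
          rw [variance_of_integral_eq_zero (hZ i).aemeasurable (h0 i)]
          exact hv i
      _ = n * v := by simp
  have heq : ∀ ω, sampleMean (fun i => Z i ω) ^ 2 = (∑ i, Z i) ω ^ 2 / (n : ℝ) ^ 2 := by
    intro ω; rw [sampleMean, div_pow, Finset.sum_apply]
  simp only [heq]
  rw [integral_div, div_le_div_iff₀ (by positivity) hn']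
  nlinarith

theorem measureReal_le_abs_le {f : Ω → ℝ} (hf : MemLp f 2 μ) {v c : ℝ}
    (hv : ∫ ω, f ω ^ 2 ∂μ ≤ v) (hc : 0 < c) : μ.real {ω | c ≤ |f ω|} ≤ v / c ^ 2 := by
  have h := mul_meas_ge_le_integral_of_nonneg (μ := μ) (f := fun ω => f ω ^ 2)
    (.of_forall fun ω => sq_nonneg _) hf.integrable_sq (c ^ 2)
  have hs : {ω | c ≤ |f ω|} = {ω | c ^ 2 ≤ f ω ^ 2} := by
    ext ω
    simp only [Set.mem_ofPred_eq]
    rw [← sq_abs (f ω)]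
    exact (pow_le_pow_iff_left₀ hc.le (abs_nonneg _) two_ne_zero).symm
  rw [le_div_iff₀ (by positivity), mul_comm, hs]
  exact h.trans hv

theorem measureReal_le_sampleMean_sub_le [IsProbabilityMeasure μ] {n : ℕ} {Z : Fin n → Ω → ℝ}
    {v c : ℝ} (hn : 0 < n) (hind : iIndepFun Z μ) (hZ : ∀ i, MemLp (Z i) 2 μ) (hv : ∀ i, ∫ ω, Z i ω ^ 2 ∂μ ≤ v)
    (hc : 0 < c) :
    μ.real {ω | c ≤ |sampleMean (fun i => Z i ω - ∫ ω', Z i ω' ∂μ)|} ≤ v / n / c ^ 2 := by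
  have hm : ∀ i, MemLp (fun ω => Z i ω - ∫ ω', Z i ω' ∂μ) 2 μ :=
    fun i => (hZ i).sub (memLp_const _)
  refine measureReal_le_abs_le (memLp_sampleMean hm) ?_ hc
  refine integral_sampleMean_sq_le hn
    (hind.comp (fun i t => t - ∫ ω', Z i ω' ∂μ) fun i => measurable_id.sub_const _) hm ?_ ?_
  · intro i
    rw [integral_sub ((hZ i).integrable one_le_two) (integrable_const _)]
    simp
  · intro i
    refine le_trans ?_ (hv i)
    rw [← variance_eq_integral (hZ i).aemeasurable]
    exact variance_le_expectation_sq (hZ i).aestronglyMeasurable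

theorem integrable_abs_pow_three {g : Ω → ℝ} (hg : MemLp g 3 μ) :
    Integrable (fun ω => |g ω| ^ 3) μ := by
  have := MemLp.integrable_norm_pow (p := 3) (f := g) (μ := μ) (by exact_mod_cast hg) (by norm_num)
  simpa only [Real.norm_eq_abs] using this

theorem integrable_pow_four {g : Ω → ℝ} (hg : MemLp g 4 μ) :
    Integrable (fun ω => g ω ^ 4) μ := by
  have := MemLp.integrable_norm_pow (p := 4) (f := g) (μ := μ) (by exact_mod_cast hg) (by norm_num)
  refine this.congr (.of_forall fun ω => ?_)
  simp only [Real.norm_eq_abs]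
  exact (by decide : Even 4).pow_abs _

theorem memLp_two_sq {g : Ω → ℝ} (hg : MemLp g 4 μ) : MemLp (fun ω => g ω ^ 2) 2 μ := by
  rw [memLp_two_iff_integrable_sq (hg.aestronglyMeasurable.fun_pow 2)]
  refine (integrable_pow_four hg).congr (.of_forall fun ω => ?_)
  simp only [← pow_mul]

/-- A weak law of large numbers for squares of variables with third moments, by truncation. -/
theorem measureReal_le_sampleMean_sq_sub_le [IsProbabilityMeasure μ] {n : ℕ} {g : Fin n → Ω → ℝ}
    {m K : ℝ} (hn : 0 < n) (hind : iIndepFun g μ) (hg : ∀ i, MemLp (g i) 3 μ) (hm : 0 < m)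
    (h2 : ∀ i, ∫ ω, g i ω ^ 2 ∂μ = m ^ 2) (h3 : ∀ i, ∫ ω, |g i ω| ^ 3 ∂μ = K * m ^ 3)
    (hK : 90 * K ≤ √n) :
    μ.real {ω | 3 / 20 * m ^ 2 ≤ |sampleMean (fun i => g i ω ^ 2) - m ^ 2|} ≤ 40 * K / √n := by
  have hn' : (0 : ℝ) < n := by positivity
  have hr : 0 < √(n : ℝ) := by positivity
  have hrn : √(n : ℝ) ^ 2 = n := Real.sq_sqrt hn'.le
  -- A truncation level of order √n makes both the chance that some variable exceeds it and the
  -- Chebyshev term of order K/√n.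
  set l : ℝ := m * √n / 2 with hl
  have hl0 : 0 < l := by positivity
  set Z : Fin n → Ω → ℝ := fun i ω => min (g i ω ^ 2) (l ^ 2) with hZdef
  have hg2 : ∀ i, MemLp (g i) 2 μ := fun i => (hg i).mono_exponent (by norm_num)
  have hZm : ∀ i, AEStronglyMeasurable (Z i) μ := fun i =>
    ((((hg i).aestronglyMeasurable.aemeasurable.pow_const 2).min
      aemeasurable_const)).aestronglyMeasurable
  have hZb : ∀ i, MemLp (Z i) 2 μ := fun i => by
    refine MemLp.of_bound (hZm i) (l ^ 2) (.of_forall fun ω => ?_)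
    rw [Real.norm_eq_abs, abs_of_nonneg (by positivity)]
    exact min_le_right _ _
  have hZ2 : ∀ i, ∫ ω, Z i ω ^ 2 ∂μ ≤ l * (K * m ^ 3) := fun i => by
    rw [← h3 i, ← integral_const_mul]
    refine integral_mono (hZb i).integrable_sq ((integrable_abs_pow_three (hg i)).const_mul l) ?_
    intro ω
    simp only [hZdef]
    rw [← sq_abs (g i ω)]
    have ht := abs_nonneg (g i ω)
    set t := |g i ω|
    rcases le_total t l with h | h
    · have : min (t ^ 2) (l ^ 2) = t ^ 2 := min_eq_left (by gcongr)
      rw [this]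
      calc (t ^ 2) ^ 2 = t * t ^ 3 := by ring
        _ ≤ l * t ^ 3 := by gcongr
    · have : min (t ^ 2) (l ^ 2) = l ^ 2 := min_eq_right (by gcongr)
      rw [this]
      calc (l ^ 2) ^ 2 = l * l ^ 3 := by ring
        _ ≤ l * t ^ 3 := by gcongr
  -- What truncation removes is at most |g|³/l, so the bias is at most 2Km²/√n, and 90K ≤ √n turns
  -- this into m²/45.
  have hbias : ∀ i, |(∫ ω, Z i ω ∂μ) - m ^ 2| ≤ 1 / 45 * m ^ 2 := fun i => by
    have h4 : ∫ ω, (g i ω ^ 2 - Z i ω) ∂μ ≤ ∫ ω, l⁻¹ * |g i ω| ^ 3 ∂μ := by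
      refine integral_mono ((hg2 i).integrable_sq.sub ((hZb i).integrable one_le_two))
        ((integrable_abs_pow_three (hg i)).const_mul _) ?_
      intro ω
      simp only [hZdef]
      rw [← sq_abs (g i ω)]
      have ht := abs_nonneg (g i ω)
      set t := |g i ω|
      rcases le_total t l with h | h
      · have : min (t ^ 2) (l ^ 2) = t ^ 2 := min_eq_left (by gcongr)
        rw [this, sub_self]; positivity
      · have : min (t ^ 2) (l ^ 2) = l ^ 2 := min_eq_right (by gcongr)
        rw [this, inv_mul_eq_div, le_div_iff₀ hl0]
        nlinarith [mul_le_mul_of_nonneg_right h (sq_nonneg t), pow_pos hl0 3]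
    have h5 : 0 ≤ ∫ ω, (g i ω ^ 2 - Z i ω) ∂μ :=
      integral_nonneg fun ω => sub_nonneg.2 (min_le_left _ _)
    rw [integral_sub (hg2 i).integrable_sq ((hZb i).integrable one_le_two), h2 i] at h4 h5
    rw [integral_const_mul, h3 i] at h4
    have h6 : l⁻¹ * (K * m ^ 3) ≤ 1 / 45 * m ^ 2 := by
      rw [inv_mul_eq_div, div_le_iff₀ hl0, hl]
      nlinarith [mul_le_mul_of_nonneg_right hK (pow_pos hm 3).le]
    rw [abs_le]
    constructor <;> nlinarith [sq_nonneg m]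
  have hK0 : 0 ≤ K * m ^ 3 := by
    rw [← h3 ⟨0, hn⟩]; exact integral_nonneg fun ω => by positivity
  have hK1 : 0 ≤ K := nonneg_of_mul_nonneg_left hK0 (by positivity)
  have hbig : ∀ i, μ.real {ω | l ^ 3 ≤ |g i ω| ^ 3} ≤ K * m ^ 3 / l ^ 3 := fun i => by
    rw [le_div_iff₀ (by positivity), mul_comm, ← h3 i]
    exact mul_meas_ge_le_integral_of_nonneg (.of_forall fun ω => by positivity)
      (integrable_abs_pow_three (hg i)) _
  -- The deviation m²/8 leaves room for the bias: 1/8 + 1/45 < 3/20.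
  have hcheb := measureReal_le_sampleMean_sub_le hn
    (hind.comp (fun _ t => min (t ^ 2) (l ^ 2))
      fun i => (measurable_id.pow_const 2).min measurable_const) hZb hZ2
    (c := 1 / 8 * m ^ 2) (by positivity)
  have hsub : {ω | 3 / 20 * m ^ 2 ≤ |sampleMean (fun i => g i ω ^ 2) - m ^ 2|} ⊆
      (⋃ i, {ω | l ^ 3 ≤ |g i ω| ^ 3}) ∪
      {ω | 1 / 8 * m ^ 2 ≤ |sampleMean (fun i => Z i ω - ∫ ω', Z i ω' ∂μ)|} := by
    intro ω hω
    by_contra hcon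
    simp only [Set.mem_union, Set.mem_iUnion, Set.mem_ofPred_eq, not_or, not_exists, not_le] at hcon
    obtain ⟨hc1, hc2⟩ := hcon
    have hc3 : ∀ i, g i ω ^ 2 = Z i ω := fun i => by
      have : |g i ω| < l := lt_of_pow_lt_pow_left₀ 3 hl0.le (hc1 i)
      refine (min_eq_left ?_).symm
      rw [← sq_abs]; gcongr
    have hc4 : sampleMean (fun i => g i ω ^ 2) - m ^ 2
        = sampleMean (fun i => Z i ω - ∫ ω', Z i ω' ∂μ)
          + sampleMean (fun i => (∫ ω', Z i ω' ∂μ) - m ^ 2) := by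
      simp only [hc3, sampleMean, Finset.sum_sub_distrib, Finset.sum_const, Finset.card_univ,
        Fintype.card_fin, nsmul_eq_mul]
      field_simp
      ring
    have hc5 : |sampleMean (fun i => (∫ ω', Z i ω' ∂μ) - m ^ 2)| ≤ 1 / 45 * m ^ 2 := by
      rw [sampleMean, abs_div, abs_of_pos hn', div_le_iff₀ hn']
      calc _ ≤ ∑ i, |(∫ ω', Z i ω' ∂μ) - m ^ 2| := Finset.abs_sum_le_sum_abs _ _
        _ ≤ ∑ _i : Fin n, 1 / 45 * m ^ 2 := Finset.sum_le_sum fun i _ => hbias i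
        _ = _ := by simp; ring
    simp only [Set.mem_ofPred_eq, hc4] at hω
    have := abs_add_le (sampleMean (fun i => Z i ω - ∫ ω', Z i ω' ∂μ))
      (sampleMean (fun i => (∫ ω', Z i ω' ∂μ) - m ^ 2))
    nlinarith [sq_pos_of_pos hm]
  calc _ ≤ _ := measureReal_mono hsub
    _ ≤ _ := measureReal_union_le _ _
    _ ≤ ∑ _i : Fin n, K * m ^ 3 / l ^ 3 + l * (K * m ^ 3) / n / (1 / 8 * m ^ 2) ^ 2 := by
        gcongr
        · exact (measureReal_iUnion_fintype_le _).trans (Finset.sum_le_sum fun i _ => hbig i)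
        · exact hcheb
    -- The union bound over large values contributes 8K/√n, Chebyshev 32K/√n.
    _ = 40 * K / √n := by
        simp only [Finset.sum_const, Finset.card_univ, Fintype.card_fin, nsmul_eq_mul, hl]
        set R := √(n : ℝ)
        rw [← hrn]
        field_simp
        ring

end Tails

/-! ### Concentration of the residual moment at rate n^{-1/2} -/

section Concentration

variable {Ω : Type*} [MeasurableSpace Ω] {μ : Measure Ω}

/-- Cauchy–Schwarz with upper bounds in place of the norms, from the weighted arithmetic–geometric
mean inequality |fg| ≤ (B/2A)f² + (A/2B)g². -/
theorem integral_abs_mul_abs_le {f g : Ω → ℝ} (hf : MemLp f 2 μ) (hg : MemLp g 2 μ) {A B : ℝ}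
    (hA : 0 < A) (hB : 0 < B) (hfA : ∫ ω, f ω ^ 2 ∂μ ≤ A ^ 2) (hgB : ∫ ω, g ω ^ 2 ∂μ ≤ B ^ 2) :
    Integrable (fun ω => |f ω| * |g ω|) μ ∧ ∫ ω, |f ω| * |g ω| ∂μ ≤ A * B := by
  have hi : Integrable (fun ω => |f ω| * |g ω|) μ := hf.norm.integrable_mul hg.norm
  refine ⟨hi, ?_⟩
  calc ∫ ω, |f ω| * |g ω| ∂μ
      ≤ ∫ ω, (B / (2 * A) * f ω ^ 2 + A / (2 * B) * g ω ^ 2) ∂μ := by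
        refine integral_mono hi
          ((hf.integrable_sq.const_mul _).add (hg.integrable_sq.const_mul _)) fun ω => ?_
        simp only
        rw [← sq_abs (f ω), ← sq_abs (g ω), ← sub_nonneg]
        have : B / (2 * A) * |f ω| ^ 2 + A / (2 * B) * |g ω| ^ 2 - |f ω| * |g ω|
            = (B * |f ω| - A * |g ω|) ^ 2 / (2 * A * B) := by
          field_simp; ring
        rw [this]; positivity
    _ = B / (2 * A) * ∫ ω, f ω ^ 2 ∂μ + A / (2 * B) * ∫ ω, g ω ^ 2 ∂μ := by
        rw [integral_add (hf.integrable_sq.const_mul _) (hg.integrable_sq.const_mul _),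
          integral_const_mul, integral_const_mul]
    _ ≤ B / (2 * A) * A ^ 2 + A / (2 * B) * B ^ 2 := by gcongr
    _ = A * B := by field_simp; ring

theorem empNorm_sq_eq_sampleMean {n : ℕ} (f : Fin n → ℝ) :
    empNorm f ^ 2 = sampleMean fun i => f i ^ 2 := empNorm_sq f

theorem memLp_empNorm {n : ℕ} {f : Fin n → Ω → ℝ} (hf : ∀ i, MemLp (f i) 2 μ) :
    MemLp (fun ω => empNorm fun i => f i ω) 2 μ := by
  have hs : Integrable (fun ω => sampleMean fun i => f i ω ^ 2) μ :=
    memLp_one_iff_integrable.1 (memLp_sampleMean fun i =>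
      memLp_one_iff_integrable.2 (hf i).integrable_sq)
  rw [memLp_two_iff_integrable_sq]
  · simpa only [empNorm_sq_eq_sampleMean] using hs
  · exact Real.continuous_sqrt.comp_aestronglyMeasurable hs.aestronglyMeasurable

theorem integral_empNorm_sq {n : ℕ} {f : Fin n → Ω → ℝ} {v : ℝ} (hn : 0 < n)
    (hf : ∀ i, MemLp (f i) 2 μ) (h : ∀ i, ∫ ω, f i ω ^ 2 ∂μ = v) :
    ∫ ω, empNorm (fun i => f i ω) ^ 2 ∂μ = v := by
  simp only [empNorm_sq_eq_sampleMean]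
  exact integral_sampleMean hn (fun i => (hf i).integrable_sq) h

/-- Integrate (t - m)²(t + m/2) ≥ 0 at t = |g|, the tangent inequality bounding t³ below by a
function of t². -/
theorem one_le_of_integral_abs_pow_three [IsProbabilityMeasure μ] {g : Ω → ℝ} {m K : ℝ}
    (hg : MemLp g 3 μ) (hm : 0 < m) (h2 : ∫ ω, g ω ^ 2 ∂μ = m ^ 2)
    (h3 : ∫ ω, |g ω| ^ 3 ∂μ = K * m ^ 3) : 1 ≤ K := by
  have hg2 : MemLp g 2 μ := hg.mono_exponent (by norm_num)
  have : ∫ ω, (3 / 2 * m * g ω ^ 2 - m ^ 3 / 2) ∂μ ≤ ∫ ω, |g ω| ^ 3 ∂μ := by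
    refine integral_mono ((hg2.integrable_sq.const_mul _).sub (integrable_const _))
      (integrable_abs_pow_three hg) fun ω => ?_
    simp only
    rw [← sq_abs]
    nlinarith [mul_nonneg (sq_nonneg (|g ω| - m)) (by positivity : 0 ≤ |g ω| + m / 2)]
  rw [integral_sub (hg2.integrable_sq.const_mul _) (integrable_const _), integral_const_mul, h2,
    h3] at this
  simp only [integral_const, probReal_univ, one_smul] at this
  have hm3 : 0 < m ^ 3 := by positivity
  by_contra! hK
  nlinarith [mul_lt_mul_of_pos_right hK hm3]

theorem one_le_of_integral_pow_four [IsProbabilityMeasure μ] {g : Ω → ℝ} {σ κ : ℝ}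
    (hg : MemLp g 4 μ) (hσ : 0 < σ) (hκ : 0 < κ) (h2 : ∫ ω, g ω ^ 2 ∂μ = σ ^ 2)
    (h4 : ∫ ω, g ω ^ 4 ∂μ = (κ * σ ^ 2) ^ 2) : 1 ≤ κ := by
  have hg2 : MemLp g 2 μ := hg.mono_exponent (by norm_num)
  have : ∫ ω, (2 * σ ^ 2 * g ω ^ 2 - σ ^ 4) ∂μ ≤ ∫ ω, g ω ^ 4 ∂μ := by
    refine integral_mono ((hg2.integrable_sq.const_mul _).sub (integrable_const _))
      (integrable_pow_four hg) fun ω => ?_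
    simp only
    nlinarith [sq_nonneg (g ω ^ 2 - σ ^ 2)]
  rw [integral_sub (hg2.integrable_sq.const_mul _) (integrable_const _), integral_const_mul, h2,
    h4] at this
  simp only [integral_const, probReal_univ, one_smul] at this
  have hs4 : 0 < σ ^ 4 := by positivity
  by_contra! hK
  have : κ ^ 2 < 1 := by nlinarith
  nlinarith [mul_lt_mul_of_pos_right this hs4]

set_option maxHeartbeats 1000000 in
/-- The residual moment concentrates at rate `n^{-1/2}` around `‖x e‖₂²`. -/
theorem measureReal_residualMoment_le [IsProbabilityMeasure μ] {n : ℕ} (hn : 0 < n)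
    {x e : Fin n → Ω → ℝ} (hind : iIndepFun (fun i ω => (x i ω, e i ω)) μ)
    (hx : ∀ i, MemLp (x i) 4 μ) (he : ∀ i, MemLp (e i) 2 μ)
    (hxe : ∀ i, MemLp (fun ω => x i ω * e i ω) 3 μ)
    (hx0 : ∀ i, ∫ ω, x i ω ∂μ = 0) (he0 : ∀ i, ∫ ω, e i ω ∂μ = 0)
    (hxe0 : ∀ i, ∫ ω, x i ω * e i ω ∂μ = 0)
    {σ s m κ K : ℝ} (hσ : 0 < σ) (hs : 0 < s) (hm : 0 < m) (hκ : 0 < κ)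
    (hx2 : ∀ i, ∫ ω, x i ω ^ 2 ∂μ = σ ^ 2) (he2 : ∀ i, ∫ ω, e i ω ^ 2 ∂μ = s ^ 2)
    (hxe2 : ∀ i, ∫ ω, (x i ω * e i ω) ^ 2 ∂μ = m ^ 2)
    (hx4 : ∀ i, ∫ ω, x i ω ^ 4 ∂μ = (κ * σ ^ 2) ^ 2)
    (hxe3 : ∀ i, ∫ ω, |x i ω * e i ω| ^ 3 ∂μ = K * m ^ 3) (c ν t : ℝ) :
    μ.real {ω | m ^ 2 / 2 ≤ |residualMoment (fun i => x i ω + c)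
        (fun i => ν + t * x i ω + e i ω) - m ^ 2|}
      ≤ (90 * K + 1120 * (σ * s / m) ^ 2 + 16 * κ) / √n := by
  have hn' : (0 : ℝ) < n := by positivity
  have hR : 0 < √(n : ℝ) := by positivity
  have hRn : √(n : ℝ) ^ 2 = n := Real.sq_sqrt hn'.le
  have hK1 : 1 ≤ K := one_le_of_integral_abs_pow_three (hxe ⟨0, hn⟩) hm (hxe2 _) (hxe3 _)
  have hκ1 : 1 ≤ κ := one_le_of_integral_pow_four (hx ⟨0, hn⟩) hσ hκ (hx2 _) (hx4 _)
  -- If √n is at most the numerator, the bound is at least 1. Otherwise √n exceeds 90K, 1120q² and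
  -- 16κ, and exceeds 106 since K, κ ≥ 1; this lets second-order terms be absorbed.
  rcases le_or_gt √(n : ℝ) (90 * K + 1120 * (σ * s / m) ^ 2 + 16 * κ) with hbig | hsmall
  · exact measureReal_le_one.trans ((one_le_div hR).2 hbig)
  set R := √(n : ℝ) with hRdef
  set q := σ * s / m with hq
  have hq0 : 0 < q := by positivity
  have hq2 : 0 ≤ 1120 * q ^ 2 := by positivity
  -- Thus ρ = n^{-1/4}: Chebyshev for |x̄| ≥ σρ costs exactly 1/√n, while ρ is small enough for the
  -- deterministic estimate.
  set ρ := √(1 / R) with hρ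
  have hρ0 : 0 < ρ := by positivity
  have hρ2 : ρ ^ 2 = 1 / R := Real.sq_sqrt (by positivity)
  have hx2' : ∀ i, MemLp (x i) 2 μ := fun i => (hx i).mono_exponent (by norm_num)
  have hxe2' : ∀ i, MemLp (fun ω => x i ω * e i ω) 2 μ := fun i =>
    (hxe i).mono_exponent (by norm_num)
  have hxsq : ∀ i, MemLp (fun ω => x i ω ^ 2) 2 μ := fun i => memLp_two_sq (hx i)
  have hix : iIndepFun x μ := hind.comp (fun _ p => p.1) fun _ => measurable_fst
  have hie : iIndepFun e μ := hind.comp (fun _ p => p.2) fun _ => measurable_snd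
  have hixe : iIndepFun (fun i ω => x i ω * e i ω) μ :=
    hind.comp (fun _ p => p.1 * p.2) fun _ => measurable_fst.mul measurable_snd
  have hix2 : iIndepFun (fun i ω => x i ω ^ 2) μ :=
    hix.comp (fun _ p => p ^ 2) fun _ => measurable_id.pow_const 2
  -- the four exceptional events
  have hB1 := measureReal_le_sampleMean_sq_sub_le hn hixe hxe hm hxe2 hxe3
    (by rw [← hRdef]; linarith)
  have hB2 := measureReal_le_sampleMean_sub_le hn hix2 hxsq (v := (κ * σ ^ 2) ^ 2)
    (fun i => by rw [← hx4 i]; simp only [← pow_mul]; exact le_rfl) (c := σ ^ 2 / 5) (by positivity)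
  have haL := memLp_sampleMean hx2'
  have hbL := memLp_sampleMean he
  have hWL := memLp_sampleMean hxe2'
  have ha2 : ∫ ω, sampleMean (fun i => x i ω) ^ 2 ∂μ ≤ (σ / R) ^ 2 := by
    rw [div_pow, hRn]
    exact integral_sampleMean_sq_le hn hix hx2' hx0 fun i => (hx2 i).le
  have hb2 : ∫ ω, sampleMean (fun i => e i ω) ^ 2 ∂μ ≤ (s / R) ^ 2 := by
    rw [div_pow, hRn]
    exact integral_sampleMean_sq_le hn hie he he0 fun i => (he2 i).le
  have hW2 : ∫ ω, sampleMean (fun i => x i ω * e i ω) ^ 2 ∂μ ≤ (m / R) ^ 2 := by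
    rw [div_pow, hRn]
    exact integral_sampleMean_sq_le hn hixe hxe2' hxe0 fun i => (hxe2 i).le
  have hB3 := measureReal_le_abs_le haL ha2 (c := σ * ρ) (by positivity)
  obtain ⟨i1, l1⟩ := integral_abs_mul_abs_le haL (memLp_empNorm he) (by positivity) hs ha2
    (integral_empNorm_sq hn he he2).le
  obtain ⟨i2, l2⟩ := integral_abs_mul_abs_le hbL (memLp_empNorm hx2') (by positivity) hσ hb2
    (integral_empNorm_sq hn hx2' hx2).le
  have hN4 : ∫ ω, empNorm (fun i => x i ω ^ 2) ^ 2 ∂μ ≤ (κ * σ ^ 2) ^ 2 := by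
    refine (integral_empNorm_sq hn hxsq fun i => ?_).le
    rw [← hx4 i]; simp only [← pow_mul]
  obtain ⟨i3, l3⟩ := integral_abs_mul_abs_le hWL (memLp_empNorm hxsq) (by positivity)
    (by positivity) hW2 hN4
  obtain ⟨i4, l4⟩ := integral_abs_mul_abs_le hbL (memLp_empNorm hxsq) (by positivity)
    (by positivity) hb2 hN4
  -- `T` is the perturbation bound of `abs_residualMoment_sub_lt`, expanded so that every summand is
  -- a constant times a mean times a norm. Replacing |x̄| by σρ in the slope avoids a product of
  -- three random factors.
  set T : Ω → ℝ := fun ω =>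
    |sampleMean fun i => x i ω| * |empNorm fun i => e i ω|
    + |sampleMean fun i => e i ω| * |empNorm fun i => x i ω|
    + 5 / 3 / σ ^ 2 * (|sampleMean fun i => x i ω * e i ω| * |empNorm fun i => x i ω ^ 2|)
    + 5 / 3 / σ ^ 2 * (σ * ρ) * (|sampleMean fun i => e i ω| * |empNorm fun i => x i ω ^ 2|)
    with hT
  have hTi : Integrable T μ := ((i1.add i2).add (i3.const_mul _)).add (i4.const_mul _)
  have hTint : ∫ ω, T ω ∂μ ≤ m * (2 * q + 5 / 3 * κ * (1 + q * ρ)) / R := by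
    have : ∫ ω, T ω ∂μ = _ := integral_add ((i1.add i2).add (i3.const_mul _)) (i4.const_mul _)
    rw [this]
    have : ∫ ω, _ ∂μ = _ := integral_add (i1.add i2) (i3.const_mul (5 / 3 / σ ^ 2))
    erw [this]
    have : ∫ ω, _ ∂μ = _ := integral_add i1 i2
    erw [this]
    rw [integral_const_mul, integral_const_mul]
    calc _ ≤ σ / R * s + s / R * σ + 5 / 3 / σ ^ 2 * (m / R * (κ * σ ^ 2))
          + 5 / 3 / σ ^ 2 * (σ * ρ) * (s / R * (κ * σ ^ 2)) := by gcongr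
      _ = _ := by rw [hq]; field_simp; ring
  have hB4 : μ.real {ω | 3 / 20 * m ≤ T ω} ≤
      (2 * q + 5 / 3 * κ * (1 + q * ρ)) / R / (3 / 20) := by
    have h := mul_meas_ge_le_integral_of_nonneg (μ := μ) (f := T)
      (.of_forall fun ω => by simp only [hT, Pi.zero_apply]; positivity) hTi (3 / 20 * m)
    rw [le_div_iff₀ (by norm_num)]
    have h2 := h.trans hTint
    rw [mul_div_assoc] at h2
    nlinarith [hm]
  have hsub : {ω | m ^ 2 / 2 ≤ |residualMoment (fun i => x i ω + c)
        (fun i => ν + t * x i ω + e i ω) - m ^ 2|} ⊆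
      {ω | 3 / 20 * m ^ 2 ≤ |sampleMean (fun i => (x i ω * e i ω) ^ 2) - m ^ 2|} ∪
      {ω | σ ^ 2 / 5 ≤ |sampleMean (fun i => x i ω ^ 2 - ∫ ω', x i ω' ^ 2 ∂μ)|} ∪
      {ω | σ * ρ ≤ |sampleMean fun i => x i ω|} ∪ {ω | 3 / 20 * m ≤ T ω} := by
    intro ω hω
    by_contra hcon
    simp only [Set.mem_union, Set.mem_ofPred_eq, not_or, not_le] at hcon
    obtain ⟨⟨⟨h1, h2⟩, h3⟩, h4⟩ := hcon
    have h2' : 4 / 5 * σ ^ 2 < empNorm (fun i => x i ω) ^ 2 := by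
      have : sampleMean (fun i => x i ω ^ 2 - ∫ ω', x i ω' ^ 2 ∂μ)
          = empNorm (fun i => x i ω) ^ 2 - σ ^ 2 := by
        rw [empNorm_sq]
        simp only [hx2, sampleMean, Finset.sum_sub_distrib, Finset.sum_const, Finset.card_univ,
          Fintype.card_fin, nsmul_eq_mul]
        field_simp
      rw [this, abs_lt] at h2
      linarith
    have hρ3 : 106 * ρ ^ 2 ≤ 1 := by
      rw [hρ2, mul_one_div, div_le_one hR]
      linarith
    have hTlt : |sampleMean fun i => x i ω| * empNorm (fun i => e i ω)
        + |sampleMean fun i => e i ω| * empNorm (fun i => x i ω)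
        + 5 / 3 * (|sampleMean ((fun i => x i ω) * fun i => e i ω)|
          + σ * ρ * |sampleMean fun i => e i ω|)
          * empNorm ((fun i => x i ω) ^ 2) / σ ^ 2 < 3 / 20 * m := by
      refine lt_of_eq_of_lt ?_ h4
      simp only [hT, abs_of_nonneg (empNorm_nonneg _)]
      change _ + 5 / 3 * (|sampleMean fun i => x i ω * e i ω|
          + σ * ρ * |sampleMean fun i => e i ω|)
          * empNorm (fun i => x i ω ^ 2) / σ ^ 2 = _
      ring
    obtain ⟨h5, h6⟩ := abs_residualMoment_sub_lt hn (fun i => x i ω) (fun i => e i ω) hm hσ hρ3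
      (by rw [empNorm_sq_eq_sampleMean]; exact h1) h2' h3 hTlt
    rw [Set.mem_ofPred_eq, residualMoment_affine hn _ _ _ _ _ h5.ne'] at hω
    linarith
  -- Here q²/√n ≤ 1/1120 < (3/100)².
  have hqρ : q * ρ ≤ 3 / 100 := by
    refine abs_le_of_sq_le_sq' ?_ (by norm_num) |>.2
    rw [mul_pow, hρ2, mul_one_div, div_le_iff₀ hR]
    linarith
  have hB3' : (σ / R) ^ 2 / (σ * ρ) ^ 2 = 1 / R := by
    rw [mul_pow, hρ2]; field_simp
  -- Chebyshev gives 25κ²/n; one factor κ/√n is traded for 1/16.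
  have hB2' : (κ * σ ^ 2) ^ 2 / n / (σ ^ 2 / 5) ^ 2 ≤ 25 / 16 * κ / R := by
    rw [← hRn, show (κ * σ ^ 2) ^ 2 / R ^ 2 / (σ ^ 2 / 5) ^ 2 = 25 * κ ^ 2 / R / R by
      field_simp; norm_num]
    gcongr
    rw [div_le_iff₀ hR]
    have : κ * (16 * κ) ≤ κ * R := by gcongr; linarith
    linarith
  -- The κ terms total about 13κ ≤ 16κ, and 1 + 40q/3 is absorbed by 50K + 1120q² since K ≥ 1.
  have htot : 40 * K / R + 25 / 16 * κ / R + 1 / R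
      + (2 * q + 5 / 3 * κ * (1 + q * ρ)) / R / (3 / 20)
      ≤ (90 * K + 1120 * q ^ 2 + 16 * κ) / R := by
    rw [show 40 * K / R + 25 / 16 * κ / R + 1 / R
      + (2 * q + 5 / 3 * κ * (1 + q * ρ)) / R / (3 / 20) = (40 * K + 25 / 16 * κ + 1
      + (2 * q + 5 / 3 * κ * (1 + q * ρ)) / (3 / 20)) / R by field_simp]
    refine div_le_div_of_nonneg_right ?_ hR.le
    have h1 := mul_le_mul_of_nonneg_left hqρ hκ.le
    have h2 := sq_nonneg (q - 1 / 100)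
    ring_nf at h1 h2 ⊢
    linarith
  refine (measureReal_mono hsub).trans ?_
  have u1 := measureReal_union_le (μ := μ)
    ({ω | 3 / 20 * m ^ 2 ≤ |sampleMean (fun i => (x i ω * e i ω) ^ 2) - m ^ 2|} ∪
      {ω | σ ^ 2 / 5 ≤ |sampleMean (fun i => x i ω ^ 2 - ∫ ω', x i ω' ^ 2 ∂μ)|} ∪
      {ω | σ * ρ ≤ |sampleMean fun i => x i ω|}) {ω | 3 / 20 * m ≤ T ω}
  have u2 := measureReal_union_le (μ := μ)
    ({ω | 3 / 20 * m ^ 2 ≤ |sampleMean (fun i => (x i ω * e i ω) ^ 2) - m ^ 2|} ∪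
      {ω | σ ^ 2 / 5 ≤ |sampleMean (fun i => x i ω ^ 2 - ∫ ω', x i ω' ^ 2 ∂μ)|})
      {ω | σ * ρ ≤ |sampleMean fun i => x i ω|}
  have u3 := measureReal_union_le (μ := μ)
    {ω | 3 / 20 * m ^ 2 ≤ |sampleMean (fun i => (x i ω * e i ω) ^ 2) - m ^ 2|}
      {ω | σ ^ 2 / 5 ≤ |sampleMean (fun i => x i ω ^ 2 - ∫ ω', x i ω' ^ 2 ∂μ)|}
  rw [hB3'] at hB3
  have hB2'' := hB2.trans hB2'
  linarith

end Concentration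

/-! ### Rosenthal's inequality with exponent four -/

section Rosenthal

variable {Ω : Type*} [MeasurableSpace Ω] {μ : Measure Ω}

theorem integrable_pow_of_memLp_four [IsProbabilityMeasure μ] {g : Ω → ℝ} (hg : MemLp g 4 μ)
    {k : ℕ} (hk : k ≤ 4) : Integrable (fun ω => g ω ^ k) μ := by
  have h1 : MemLp g k μ := hg.mono_exponent (by exact_mod_cast hk)
  have h2 := h1.integrable_norm_pow'
  refine h2.mono (h1.aestronglyMeasurable.fun_pow k) (.of_forall fun ω => ?_)
  simp

/-- In the binomial expansion, independence makes every term with a first power vanish. -/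
theorem integral_add_pow_four [IsProbabilityMeasure μ] {S Z : Ω → ℝ} (hSZ : IndepFun S Z μ)
    (hS : MemLp S 4 μ) (hZ : MemLp Z 4 μ) (hS0 : ∫ ω, S ω ∂μ = 0) (hZ0 : ∫ ω, Z ω ∂μ = 0) :
    ∫ ω, (S ω + Z ω) ^ 4 ∂μ = ∫ ω, S ω ^ 4 ∂μ
      + 6 * ((∫ ω, S ω ^ 2 ∂μ) * ∫ ω, Z ω ^ 2 ∂μ) + ∫ ω, Z ω ^ 4 ∂μ := by
  have hind : ∀ j k : ℕ, IndepFun (fun ω => S ω ^ j) (fun ω => Z ω ^ k) μ := fun j k =>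
    hSZ.comp (measurable_id.pow_const j) (measurable_id.pow_const k)
  have hi : ∀ j k : ℕ, j ≤ 4 → k ≤ 4 → Integrable (fun ω => S ω ^ j * Z ω ^ k) μ :=
    fun j k hj hk => (hind j k).integrable_mul (integrable_pow_of_memLp_four hS hj)
      (integrable_pow_of_memLp_four hZ hk)
  have he : ∀ j k : ℕ, ∫ ω, S ω ^ j * Z ω ^ k ∂μ = (∫ ω, S ω ^ j ∂μ) * ∫ ω, Z ω ^ k ∂μ :=
    fun j k => (hind j k).integral_fun_mul_eq_mul_integral
      (hS.aestronglyMeasurable.fun_pow j) (hZ.aestronglyMeasurable.fun_pow k)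
  have hexp : ∀ ω, (S ω + Z ω) ^ 4
      = ∑ j ∈ Finset.range 5, (Nat.choose 4 j : ℝ) * (S ω ^ j * Z ω ^ (4 - j)) := fun ω => by
    rw [add_pow]; exact Finset.sum_congr rfl fun j _ => by ring
  simp only [hexp]
  rw [integral_finsetSum]
  · simp only [integral_const_mul, he, Finset.sum_range_succ, Finset.sum_range_zero]
    norm_num [hS0, hZ0, Nat.choose]
    ring
  · intro j hj
    exact (hi j (4 - j) (by simp at hj; omega) (by omega)).const_mul _

/-- Induction on the index set. The second moment is carried along because the cross term 6·E S²·E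
Z² needs it; adding one variable raises 3(kv)² by 6kv² + 3v², enough to cover it. -/
theorem integral_sum_pow_le [IsProbabilityMeasure μ] {ι : Type*} {Z : ι → Ω → ℝ}
    (hind : iIndepFun Z μ) (hZ : ∀ i, MemLp (Z i) 4 μ) (h0 : ∀ i, ∫ ω, Z i ω ∂μ = 0) {v M : ℝ}
    (hv : ∀ i, ∫ ω, Z i ω ^ 2 ∂μ = v) (hM : ∀ i, ∫ ω, Z i ω ^ 4 ∂μ = M) (s : Finset ι) :
    ∫ ω, (∑ i ∈ s, Z i) ω ^ 2 ∂μ = s.card * v ∧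
    ∫ ω, (∑ i ∈ s, Z i) ω ^ 4 ∂μ ≤ s.card * M + 3 * (s.card * v) ^ 2 := by
  classical
  induction s using Finset.induction_on with
  | empty => simp
  | insert i s hi ih =>
    have hS : MemLp (∑ j ∈ s, Z j) 4 μ := memLp_finsetSum' _ fun j _ => hZ j
    have hS0 : ∫ ω, (∑ j ∈ s, Z j) ω ∂μ = 0 := by
      simp only [Finset.sum_apply]
      rw [integral_finsetSum _ fun j _ => (hZ j).integrable (by norm_num)]
      simp [h0]
    have hSZ : IndepFun (∑ j ∈ s, Z j) (Z i) μ :=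
      hind.indepFun_finsetSum_of_notMem₀ (fun j => (hZ j).aemeasurable) hi
    have hS2 : MemLp (∑ j ∈ s, Z j) 2 μ := hS.mono_exponent (by norm_num)
    have hZ2 : MemLp (Z i) 2 μ := (hZ i).mono_exponent (by norm_num)
    rw [Finset.sum_insert hi, Finset.card_insert_of_notMem hi, add_comm (Z i)]
    simp only [Pi.add_apply, Nat.cast_add, Nat.cast_one]
    rw [integral_add_pow_four hSZ hS (hZ i) hS0 (h0 i), ih.1, hv, hM]
    constructor
    · have hvar := hSZ.variance_add hS2 hZ2
      rw [variance_of_integral_eq_zero (hS2.add hZ2).aemeasurable,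
        variance_of_integral_eq_zero hS2.aemeasurable hS0,
        variance_of_integral_eq_zero hZ2.aemeasurable (h0 i), ih.1, hv] at hvar
      · simp only [Pi.add_apply] at hvar
        rw [hvar]; ring
      · simp only [Pi.add_apply]
        rw [integral_add (hS.integrable (by norm_num)) ((hZ i).integrable (by norm_num)), hS0,
          h0, add_zero]
    · nlinarith [ih.2, sq_nonneg v]

theorem eLpNorm_pow_eq [IsProbabilityMeasure μ] {f : Ω → ℝ} {k : ℕ} (hk : k ≠ 0)
    (hf : MemLp f k μ) : eLpNorm f k μ ^ k = ENNReal.ofReal (∫ ω, |f ω| ^ k ∂μ) := by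
  rw [hf.eLpNorm_eq_integral_rpow_norm (by exact_mod_cast hk) (ENNReal.natCast_ne_top k),
    ← ENNReal.ofReal_pow (by positivity)]
  congr 1
  simp only [ENNReal.toReal_natCast, Real.rpow_natCast, Real.norm_eq_abs]
  exact Real.rpow_inv_natCast_pow (integral_nonneg fun ω => by positivity) hk

theorem eLpNorm_four_pow [IsProbabilityMeasure μ] {f : Ω → ℝ} (hf : MemLp f 4 μ) :
    eLpNorm f 4 μ ^ 4 = ENNReal.ofReal (∫ ω, f ω ^ 4 ∂μ) := by
  have h := eLpNorm_pow_eq (k := 4) (f := f) (μ := μ) (by norm_num) (by exact_mod_cast hf)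
  simp only [(by decide : Even 4).pow_abs] at h
  exact_mod_cast h

theorem rosenthalBound_one_one : RosenthalBound 1 1 4 := by
  intro Ω _ P _ n Z i₀ hind hid hL h0
  have hn : 0 < n := i₀.pos
  have hn' : (0 : ℝ) < n := by positivity
  have hL4 : MemLp (Z i₀) 4 P := by exact_mod_cast hL
  have hZ : ∀ i, MemLp (Z i) 4 P := fun i => (hid i).memLp_iff.2 hL4
  have hm : ∀ i, ∫ ω, Z i ω ∂P = 0 := fun i => (hid i).integral_eq.trans h0
  set v := ∫ ω, Z i₀ ω ^ 2 ∂P with hv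
  set M := ∫ ω, Z i₀ ω ^ 4 ∂P with hM
  have hv0 : 0 ≤ v := integral_nonneg fun ω => by positivity
  have hM0 : 0 ≤ M := integral_nonneg fun ω => by positivity
  have h4 := (integral_sum_pow_le hind hZ hm (v := v) (M := M)
    (fun i => ((hid i).comp (measurable_id.pow_const 2)).integral_eq)
    (fun i => ((hid i).comp (measurable_id.pow_const 4)).integral_eq) Finset.univ).2
  simp only [Finset.card_univ, Fintype.card_fin] at h4
  have hmean : MemLp (fun ω => (∑ i, Z i ω) / n) 4 P := memLp_sampleMean hZ
  have hI : ∫ ω, ((∑ i, Z i ω) / n) ^ 4 ∂P ≤ (n * M + 3 * (n * v) ^ 2) / (n : ℝ) ^ 4 := by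
    simp only [div_pow]
    rw [integral_div]
    simp only [Finset.sum_apply] at h4
    gcongr
  have hvar : Var[Z i₀; P] = v := variance_of_integral_eq_zero hL4.aemeasurable h0
  have hq : ((4 : ℝ≥0) : ℝ≥0∞) = 4 := by norm_num
  have hLe : eLpNorm (Z i₀) 4 P = ENNReal.ofReal (M ^ (1 / 4 : ℝ)) := by
    refine (ENNReal.pow_right_strictMono (n := 4) (by norm_num)).injective ?_
    rw [eLpNorm_four_pow hL4, ← hM, ← ENNReal.ofReal_pow (by positivity), ← Real.rpow_natCast,
      ← Real.rpow_mul hM0]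
    norm_num
  refine (ENNReal.pow_right_strictMono (n := 4) (by norm_num)).le_iff_le.1 ?_
  rw [hq, eLpNorm_four_pow hmean, hLe, stdDev, hvar]
  have h2 : (4 : ℝ≥0∞) ^ (1 / 2 : ℝ) = ENNReal.ofReal 2 := by
    rw [show (4 : ℝ≥0∞) = ENNReal.ofReal (2 ^ (2 : ℝ)) by norm_num,
      ENNReal.ofReal_rpow_of_pos (by positivity), ← Real.rpow_mul (by norm_num)]
    norm_num
  have hnn : (n : ℝ≥0∞) = ENNReal.ofReal n := by simp
  rw [h2, hnn, ENNReal.ofReal_rpow_of_pos hn', ENNReal.ofReal_rpow_of_pos hn',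
    ← ENNReal.ofReal_div_of_pos (by positivity), ← ENNReal.ofReal_div_of_pos (by positivity),
    show (4 : ℝ≥0∞) = ENNReal.ofReal 4 by norm_num, ENNReal.coe_one, one_mul, one_mul,
    ← ENNReal.ofReal_mul (by norm_num), ← ENNReal.ofReal_mul (by norm_num),
    ← ENNReal.ofReal_add (by positivity) (by positivity), ← ENNReal.ofReal_pow (by positivity)]
  refine ENNReal.ofReal_le_ofReal (hI.trans ?_)
  -- The two Rosenthal terms have fourth powers 16v²/n² and 256M/n³, which dominate 3v²/n² and M/n³;
  -- then A⁴ + B⁴ ≤ (A + B)⁴.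
  set A := 2 * (√v / (n : ℝ) ^ (1 / 2 : ℝ)) with hA
  set B := 4 * (M ^ (1 / 4 : ℝ) / (n : ℝ) ^ ((((4 : ℝ≥0) : ℝ) - 1) / ((4 : ℝ≥0) : ℝ))) with hB
  have hA0 : 0 ≤ A := by positivity
  have hB0 : 0 ≤ B := by positivity
  have hA4 : A ^ 4 = 16 * v ^ 2 / n ^ 2 := by
    have h1 : ((n : ℝ) ^ (1 / 2 : ℝ)) ^ 4 = (n : ℝ) ^ 2 := by
      rw [← Real.rpow_natCast, ← Real.rpow_mul hn'.le, ← Real.rpow_natCast]; norm_num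
    have h3 : √v ^ 4 = v ^ 2 := by
      rw [show √v ^ 4 = (√v ^ 2) ^ 2 by ring, Real.sq_sqrt hv0]
    rw [hA, mul_pow, div_pow, h1, h3]; ring
  have hB4 : B ^ 4 = 256 * M / n ^ 3 := by
    have h1 : ((n : ℝ) ^ ((((4 : ℝ≥0) : ℝ) - 1) / ((4 : ℝ≥0) : ℝ))) ^ 4 = (n : ℝ) ^ 3 := by
      rw [← Real.rpow_natCast, ← Real.rpow_mul hn'.le, ← Real.rpow_natCast]; norm_num
    have h3 : (M ^ (1 / 4 : ℝ)) ^ 4 = M := by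
      rw [← Real.rpow_natCast, ← Real.rpow_mul hM0]; norm_num
    rw [hB, mul_pow, div_pow, h1, h3]; ring
  calc (n * M + 3 * (n * v) ^ 2) / (n : ℝ) ^ 4 = M / n ^ 3 + 3 * v ^ 2 / n ^ 2 := by field_simp
    _ ≤ B ^ 4 + A ^ 4 := by
        rw [hA4, hB4]; gcongr <;> nlinarith [sq_nonneg v]
    _ ≤ (A + B) ^ 4 := by
        have : 0 ≤ 4 * A ^ 3 * B + 6 * A ^ 2 * B ^ 2 + 4 * A * B ^ 3 := by positivity
        nlinarith

end Rosenthal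

/-! ### The population quantities -/

section PopulationLemmas

variable {Ω : Type*} [MeasurableSpace Ω] {P : Measure Ω} {X Y : Ω → ℝ}

theorem memLp_centered [IsProbabilityMeasure P] {p : ℝ≥0∞} (hX : MemLp X p P) : MemLp (centered X P) p P :=
  hX.sub (memLp_const _)

theorem memLp_regError {p : ℝ≥0∞} (hx : MemLp (centered X P) p P)
    (hy : MemLp (centered Y P) p P) : MemLp (regError X Y P) p P :=
  hy.sub (hx.const_mul _)

theorem integral_centered [IsProbabilityMeasure P] (hX : Integrable X P) : ∫ ω, centered X P ω ∂P = 0 := by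
  simp only [centered]
  rw [integral_sub hX (integrable_const _)]
  simp

theorem integral_centered_sq (hX : MemLp X 2 P) : ∫ ω, centered X P ω ^ 2 ∂P = Var[X; P] :=
  (variance_eq_integral hX.aemeasurable).symm

theorem eLpNorm_two_eq [IsProbabilityMeasure P] {f : Ω → ℝ} (hf : MemLp f 2 P) :
    eLpNorm f 2 P = ENNReal.ofReal √(∫ ω, f ω ^ 2 ∂P) := by
  refine (ENNReal.pow_right_strictMono (n := 2) (by norm_num)).injective ?_
  have h := eLpNorm_pow_eq (k := 2) (f := f) (μ := P) (by norm_num) (by exact_mod_cast hf)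
  simp only [sq_abs] at h
  rw [← ENNReal.ofReal_pow (by positivity), Real.sq_sqrt (integral_nonneg fun ω => sq_nonneg _)]
  exact_mod_cast h

theorem stdDev_eq_eLpNorm [IsProbabilityMeasure P] (hX : MemLp X 2 P) : stdDev X P = eLpNorm (centered X P) 2 P := by
  rw [eLpNorm_two_eq (memLp_centered hX), integral_centered_sq hX, stdDev]

theorem stdDev_ne_top {Z : Ω → ℝ} : stdDev Z P ≠ ∞ := ENNReal.ofReal_ne_top

theorem integral_centered_mul_regError [IsProbabilityMeasure P] (hX : MemLp X 2 P) (hY : MemLp Y 2 P)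
    (hvar : Var[X; P] ≠ 0) : ∫ ω, centered X P ω * regError X Y P ω ∂P = 0 := by
  have hx := memLp_centered hX
  have hy := memLp_centered hY
  have h : ∀ ω, centered X P ω * regError X Y P ω
      = centered Y P ω * centered X P ω - slope X Y P * centered X P ω ^ 2 := fun ω => by
    rw [regError]; ring
  have hc : ∫ ω, centered Y P ω * centered X P ω ∂P = cov[Y, X; P] := rfl
  have hyx : Integrable (fun ω => centered Y P ω * centered X P ω) P := hy.integrable_mul hx
  simp only [h]
  rw [integral_sub hyx (hx.integrable_sq.const_mul _), integral_const_mul,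
    integral_centered_sq hX, hc, slope, div_mul_cancel₀ _ hvar, sub_self]

/-- Pythagoras: ε is orthogonal to X̃ in L², and Ỹ = ε + τX̃. -/
theorem integral_regError_sq_le [IsProbabilityMeasure P] (hX : MemLp X 2 P) (hY : MemLp Y 2 P) (hvar : Var[X; P] ≠ 0) :
    ∫ ω, regError X Y P ω ^ 2 ∂P ≤ Var[Y; P] := by
  have hx := memLp_centered hX
  have he := memLp_regError hx (memLp_centered hY)
  have hxe : Integrable (fun ω => centered X P ω * regError X Y P ω) P := hx.integrable_mul he
  have h : ∀ ω, centered Y P ω ^ 2 = regError X Y P ω ^ 2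
      + (2 * slope X Y P * (centered X P ω * regError X Y P ω)
        + slope X Y P ^ 2 * centered X P ω ^ 2) := fun ω => by
    rw [regError]; ring
  rw [← integral_centered_sq hY]
  simp only [h]
  have hi : Integrable (fun ω => 2 * slope X Y P * (centered X P ω * regError X Y P ω)
      + slope X Y P ^ 2 * centered X P ω ^ 2) P :=
    (hxe.const_mul _).add (hx.integrable_sq.const_mul _)
  rw [integral_add he.integrable_sq hi, integral_add (hxe.const_mul _) (hx.integrable_sq.const_mul _), integral_const_mul,
    integral_const_mul, integral_centered_mul_regError hX hY hvar, mul_zero, zero_add]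
  have : 0 ≤ ∫ ω, centered X P ω ^ 2 ∂P := integral_nonneg fun ω => sq_nonneg _
  nlinarith [sq_nonneg (slope X Y P)]

/-- If X̃Ỹ vanishes almost surely, the covariance is zero, so τ = 0 and ε = Ỹ, whence X̃ε vanishes
too. -/
theorem not_centered_mul_centered_ae_eq_zero
    (h : ¬ (centered X P * regError X Y P =ᵐ[P] 0)) :
    ¬ (centered X P * centered Y P =ᵐ[P] 0) := by
  intro h0
  apply h
  have hc : cov[Y, X; P] = 0 := by
    change ∫ ω, centered Y P ω * centered X P ω ∂P = 0
    refine integral_eq_zero_of_ae ?_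
    filter_upwards [h0] with ω hω
    simpa [mul_comm] using hω
  filter_upwards [h0] with ω hω
  simpa [regError, slope, hc] using hω

theorem eLpNorm_ne_zero_of_not_ae {f : Ω → ℝ} {p : ℝ≥0∞} (hp : p ≠ 0)
    (hf : AEStronglyMeasurable f P) (h : ¬ (f =ᵐ[P] 0)) : eLpNorm f p P ≠ 0 :=
  fun h0 => h ((eLpNorm_eq_zero_iff hf hp).1 h0)

theorem holderTriple_six_six_three : ENNReal.HolderTriple 6 6 3 := by
  refine ⟨(ENNReal.toReal_eq_toReal_iff' (by finiteness) (by finiteness)).1 ?_⟩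
  rw [ENNReal.toReal_add (by finiteness) (by finiteness)]
  norm_num

theorem holderTriple_six_three_two : ENNReal.HolderTriple 6 3 2 := by
  refine ⟨(ENNReal.toReal_eq_toReal_iff' (by finiteness) (by finiteness)).1 ?_⟩
  rw [ENNReal.toReal_add (by finiteness) (by finiteness)]
  norm_num

theorem holderTriple_six_two : ENNReal.HolderTriple 6 2 (3 / 2) := by
  refine ⟨(ENNReal.toReal_eq_toReal_iff' (by finiteness) (by simp)).1 ?_⟩
  rw [ENNReal.toReal_add (by finiteness) (by finiteness)]
  norm_num

theorem holderTriple_four_four_two : ENNReal.HolderTriple 4 4 2 := by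
  refine ⟨(ENNReal.toReal_eq_toReal_iff' (by finiteness) (by finiteness)).1 ?_⟩
  rw [ENNReal.toReal_add (by finiteness) (by finiteness)]
  norm_num

/-- The moment ratios are finite when `X` and `Y` have moments of order six. -/
theorem moment_ratios_lt_top [IsProbabilityMeasure P] (c₁ c₂ : ℝ≥0) (hX : MemLp X 6 P) (hY : MemLp Y 6 P)
    (h : ¬ (centered X P * regError X Y P =ᵐ[P] 0)) :
    G1 X Y P < ∞ ∧ G2 c₁ X Y P < ∞ ∧ G3 c₂ X Y P < ∞ := by
  have hx := memLp_centered hX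
  have hy := memLp_centered hY
  have he := memLp_regError hx hy
  have hxy0 := not_centered_mul_centered_ae_eq_zero h
  have hX2 : MemLp X 2 P := hX.mono_exponent (by norm_num)
  have hY2 : MemLp Y 2 P := hY.mono_exponent (by norm_num)
  have := holderTriple_six_six_three
  have := holderTriple_six_three_two
  have := holderTriple_six_two
  have hsX : stdDev X P ≠ 0 := by
    rw [stdDev_eq_eLpNorm hX2]
    refine eLpNorm_ne_zero_of_not_ae (by norm_num) hx.aestronglyMeasurable fun h0 => h ?_
    filter_upwards [h0] with ω hω
    simp [hω]
  have hsY : stdDev Y P ≠ 0 := by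
    rw [stdDev_eq_eLpNorm hY2]
    refine eLpNorm_ne_zero_of_not_ae (by norm_num) hy.aestronglyMeasurable fun h0 => hxy0 ?_
    filter_upwards [h0] with ω hω
    simp [hω]
  have hsX' : stdDev X P ≠ ∞ := stdDev_ne_top
  have hsY' : stdDev Y P ≠ ∞ := stdDev_ne_top
  have hse' : stdDev (regError X Y P) P ≠ ∞ := stdDev_ne_top
  unfold G1 G2 G3
  set x := centered X P
  set y := centered Y P
  set e := regError X Y P
  have hx0 : ¬ (x =ᵐ[P] 0) := fun h0 => h (by filter_upwards [h0] with ω hω; simp [hω])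
  -- Hölder, one factor from L⁶ at a time: 6·6 → 3, 6·3 → 2, 6·2 → 3/2. The last exponent is the one
  -- `G1` requires of X̃³Ỹ.
  have hxy : MemLp (x * y) 3 P := hy.mul hx
  have hxe : MemLp (x * e) 3 P := he.mul hx
  have hx2y : MemLp (x ^ 2 * y) 2 P := by
    have : MemLp (x * (x * y)) 2 P := hxy.mul hx
    rwa [← mul_assoc, ← sq] at this
  have hy2x : MemLp (y ^ 2 * x) 2 P := by
    have : MemLp (y * (x * y)) 2 P := hxy.mul hy
    rwa [show y * (x * y) = y ^ 2 * x by ring] at this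
  have hx3y : MemLp (x ^ 3 * y) (3 / 2) P := by
    have : MemLp (x * (x ^ 2 * y)) (3 / 2) P := hx2y.mul hx
    rwa [show x * (x ^ 2 * y) = x ^ 3 * y by ring] at this
  have one_le : (1 : ℝ≥0∞) ≤ 3 / 2 := by
    rw [ENNReal.le_div_iff_mul_le (by norm_num) (by norm_num)]; norm_num
  -- The mixed denominators vanish only where X̃Ỹ does, so none has zero norm.
  have ae0 : ∀ f : Ω → ℝ, (∀ ω, f ω = 0 → x ω * y ω = 0) → ¬ (f =ᵐ[P] 0) := fun f hf h0 =>
    hxy0 (by filter_upwards [h0] with ω hω; exact hf ω hω)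
  have n1 : eLpNorm (y ^ 2 * x) 1 P ≠ 0 :=
    eLpNorm_ne_zero_of_not_ae one_ne_zero hy2x.1 (ae0 _ fun ω => by simp; tauto)
  have n2 : eLpNorm (x ^ 2 * y) 1 P ≠ 0 :=
    eLpNorm_ne_zero_of_not_ae one_ne_zero hx2y.1 (ae0 _ fun ω => by simp)
  have n3 : eLpNorm (x ^ 3 * y) 1 P ≠ 0 :=
    eLpNorm_ne_zero_of_not_ae one_ne_zero hx3y.1 (ae0 _ fun ω => by simp)
  have n4 : eLpNorm (x * e) 2 P ≠ 0 := eLpNorm_ne_zero_of_not_ae two_ne_zero hxe.1 h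
  have n5 : eLpNorm x 3 P ≠ 0 := eLpNorm_ne_zero_of_not_ae (by norm_num) hx.1 hx0
  have n6 : eLpNorm x 4 P ≠ 0 := eLpNorm_ne_zero_of_not_ae (by norm_num) hx.1 hx0
  have f1 : eLpNorm (y ^ 2 * x) 2 P ≠ ∞ := hy2x.2.ne
  have f2 : eLpNorm (x ^ 2 * y) 2 P ≠ ∞ := hx2y.2.ne
  have f3 : eLpNorm (x ^ 3 * y) (3 / 2) P ≠ ∞ := hx3y.2.ne
  have f4 : eLpNorm (x * e) 3 P ≠ ∞ := hxe.2.ne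
  have f5 : eLpNorm x 6 P ≠ ∞ := hx.2.ne
  have f6 : eLpNorm x 4 P ≠ ∞ := (hx.mono_exponent (by norm_num)).2.ne
  have f7 : eLpNorm x 3 P ≠ ∞ := (hx.mono_exponent (by norm_num)).2.ne
  have f8 : eLpNorm y 4 P ≠ ∞ := (hy.mono_exponent (by norm_num)).2.ne
  have f9 : eLpNorm (x * y) 2 P ≠ ∞ := (hxy.mono_exponent (by norm_num)).2.ne
  have f10 : eLpNorm (y ^ 2 * x) 1 P ≠ ∞ := (hy2x.mono_exponent (by norm_num)).2.ne
  have f11 : eLpNorm (x ^ 2 * y) 1 P ≠ ∞ := (hx2y.mono_exponent (by norm_num)).2.ne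
  have f12 : eLpNorm (x ^ 3 * y) 1 P ≠ ∞ := (hx3y.mono_exponent one_le).2.ne
  have n7 : eLpNorm (x ^ 3 * y) 1 P ^ (3 / 2 : ℝ) ≠ 0 := by
    simp only [ne_eq, ENNReal.rpow_eq_zero_iff, n3, false_and, false_or, not_and, not_lt]
    intro _; norm_num
  have f13 : eLpNorm (x ^ 3 * y) (3 / 2) P ^ (3 / 2 : ℝ) ≠ ∞ :=
    ENNReal.rpow_ne_top_of_nonneg (by norm_num) f3
  have f14 : (2 : ℝ≥0∞) ^ (1 / 2 : ℝ) ≠ ∞ := ENNReal.rpow_ne_top_of_nonneg (by norm_num) (by simp)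
  have f15 : (2 : ℝ≥0∞) ^ (7 / 2 : ℝ) ≠ ∞ := ENNReal.rpow_ne_top_of_nonneg (by norm_num) (by simp)
  have three : (3 : ℝ≥0∞) ≠ ∞ := by norm_num
  simp only [ENNReal.add_lt_top]
  refine ⟨?_, ?_, ?_⟩
  · repeat' apply And.intro
    all_goals
      refine ENNReal.div_lt_top (by finiteness) ?_
      simp only [ne_eq, mul_eq_zero, not_or, pow_eq_zero_iff, OfNat.ofNat_ne_zero,
        not_false_eq_true, and_self, *]
  · repeat' apply And.intro
    · finiteness
    all_goals
      refine ENNReal.div_lt_top (by finiteness) ?_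
      simp only [ne_eq, mul_eq_zero, not_or, pow_eq_zero_iff, OfNat.ofNat_ne_zero,
        not_false_eq_true, and_self, *]
  · refine ENNReal.mul_lt_top (by finiteness) (ENNReal.add_lt_top.2 ⟨?_, ?_⟩)
    all_goals
      refine ENNReal.div_lt_top (by finiteness) ?_
      simp only [ne_eq, pow_eq_zero_iff, OfNat.ofNat_ne_zero, not_false_eq_true, *]

end PopulationLemmas

/-! ### The deviation bound -/

section MainBound

variable {Ω : Type*} [MeasurableSpace Ω] {P : Measure Ω}

theorem two_rpow_half_bound : ENNReal.ofReal 90 ≤ 64 * (2 : ℝ≥0∞) ^ (1 / 2 : ℝ) := by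
  rw [show (2 : ℝ≥0∞) = ENNReal.ofReal 2 by simp, ENNReal.ofReal_rpow_of_pos (by norm_num),
    show (64 : ℝ≥0∞) = ENNReal.ofReal 64 by simp, ← ENNReal.ofReal_mul (by norm_num),
    ← Real.sqrt_eq_rpow]
  refine ENNReal.ofReal_le_ofReal ?_
  have : (90 / 64 : ℝ) ≤ √2 := Real.le_sqrt_of_sq_le (by norm_num)
  linarith

/-- Finiteness of `G₁` forces the moments used in the deviation bound to be finite. -/
theorem memLp_of_G1_ne_top [IsProbabilityMeasure P] {X Y : Ω → ℝ} (hX : MemLp X 2 P)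
    (hY : MemLp Y 2 P) (hG : G1 X Y P ≠ ∞) :
    MemLp (centered X P) 4 P ∧ MemLp (centered X P * regError X Y P) 3 P := by
  have hx := memLp_centered hX
  have hy := memLp_centered hY
  have := holderTriple_four_four_two
  unfold G1 at hG
  simp only [ne_eq, ENNReal.add_eq_top, not_or] at hG
  -- The summands kept are those in ‖X̃ε‖₃, ‖Ỹ‖₄ and ‖X̃‖₄. As ∞/∞ is 0, an infinite numerator gives
  -- a contradiction only over a finite denominator: the fourth moments come first and show ‖X̃ε‖₂
  -- finite before ‖X̃ε‖₃ is treated.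
  obtain ⟨⟨⟨⟨⟨⟨⟨⟨⟨⟨⟨⟨⟨⟨⟨⟨⟨⟨⟨-, -⟩, h3⟩, -⟩, -⟩, -⟩, -⟩, -⟩, -⟩, -⟩, -⟩, -⟩, -⟩, -⟩, h15⟩, h16⟩,
    -⟩, -⟩, -⟩, -⟩ := hG
  have hx4 : MemLp (centered X P) 4 P := by
    refine ⟨hx.1, lt_top_iff_ne_top.2 fun ht => h16 ?_⟩
    rw [ht]
    have : stdDev X P ^ 2 ≠ ∞ := ENNReal.pow_ne_top stdDev_ne_top
    simp [ENNReal.top_div, this]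
  have hy4 : MemLp (centered Y P) 4 P := by
    refine ⟨hy.1, lt_top_iff_ne_top.2 fun ht => h15 ?_⟩
    rw [ht]
    have : stdDev Y P ^ 2 ≠ ∞ := ENNReal.pow_ne_top stdDev_ne_top
    simp [ENNReal.top_div, this]
  have he4 := memLp_regError hx4 hy4
  have hxe : MemLp (centered X P * regError X Y P) 2 P := he4.mul hx4
  refine ⟨hx4, hxe.1, lt_top_iff_ne_top.2 fun ht => h3 ?_⟩
  rw [ht]
  have : eLpNorm (centered X P * regError X Y P) 2 P ^ 3 ≠ ∞ := ENNReal.pow_ne_top hxe.2.ne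
  simp [ENNReal.top_div, this, ENNReal.mul_top]

theorem three_terms_le_G1 (X Y : Ω → ℝ) :
    64 * 2 ^ (1 / 2 : ℝ) * eLpNorm (centered X P * regError X Y P) 3 P ^ 3
        / eLpNorm (centered X P * regError X Y P) 2 P ^ 3
      + 1120 * eLpNorm (centered X P) 3 P ^ 3 * stdDev Y P ^ 2
        / (eLpNorm (centered X P * regError X Y P) 2 P ^ 2 * stdDev X P)
      + 16 * eLpNorm (centered X P) 4 P ^ 2 / stdDev X P ^ 2 ≤ G1 X Y P := by
  have key : ∀ a b c d e f g h i j k l m n o p q r s t : ℝ≥0∞,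
      c + b + p ≤ a + b + c + d + e + f + g + h + i + j + k + l + m + n + o + p + q + r + s + t := by
    intro a b c d e f g h i j k l m n o p q r s t
    refine le_of_le_of_eq (le_self_add (b := a + d + e + f + g + h + i + j + k + l + m + n + o + q
      + r + s + t)) (by abel)
  exact key _ _ _ _ _ _ _ _ _ _ _ _ _ _ _ _ _ _ _ _

theorem measure_residualMoment_le_G1 [IsProbabilityMeasure P] {X Y : Ω → ℝ} (hX : MemLp X 2 P)
    (hY : MemLp Y 2 P) (h : ¬ (centered X P * regError X Y P =ᵐ[P] 0)) {Ω' : Type*}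
    [MeasurableSpace Ω'] {P' : Measure Ω'} [IsProbabilityMeasure P'] {n : ℕ}
    {Xs Ys : Fin n → Ω' → ℝ} (hn : 1 ≤ n)
    (hind : iIndepFun (fun (i : Fin n) (ω : Ω') => (Xs i ω, Ys i ω)) P')
    (hid : ∀ i, IdentDistrib (fun ω => (Xs i ω, Ys i ω)) (fun ω => (X ω, Y ω)) P' P) :
    P' {ω | (eLpNorm (centered X P * regError X Y P) 2 P).toReal ^ 2 / 2 ≤
        |residualMoment (fun i => Xs i ω) (fun i => Ys i ω)
          - (eLpNorm (centered X P * regError X Y P) 2 P).toReal ^ 2|} ≤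
      G1 X Y P / (n : ℝ≥0∞) ^ (1 / 2 : ℝ) := by
  have hn0 : 0 < n := hn
  have hn' : (0 : ℝ) < n := by positivity
  have hnr : (n : ℝ≥0∞) ^ (1 / 2 : ℝ) = ENNReal.ofReal √n := by
    rw [show (n : ℝ≥0∞) = ENNReal.ofReal n by simp, ENNReal.ofReal_rpow_of_pos hn',
      ← Real.sqrt_eq_rpow]
  rw [hnr]
  by_cases hG : G1 X Y P = ∞
  -- This also disposes of ‖X̃ε‖₂ = ∞, which forces `G1` = ∞ by `memLp_of_G1_ne_top`.
  · rw [hG, ENNReal.top_div_of_ne_top ENNReal.ofReal_ne_top]; exact le_top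
  obtain ⟨hx4, hxe3⟩ := memLp_of_G1_ne_top hX hY hG
  have hx := memLp_centered hX
  have hy := memLp_centered hY
  have he := memLp_regError hx hy
  have hxe2 : MemLp (centered X P * regError X Y P) 2 P := hxe3.mono_exponent (by norm_num)
  -- positivity of the population moments
  have hpos : ∀ {f : Ω → ℝ}, MemLp f 2 P →
      (∀ ω, f ω = 0 → centered X P ω * regError X Y P ω = 0) → 0 < ∫ ω, f ω ^ 2 ∂P := by
    intro f hf hf0
    refine (integral_nonneg fun ω => sq_nonneg _).lt_of_ne fun h0 => h ?_
    have := (integral_eq_zero_iff_of_nonneg (fun ω => sq_nonneg (f ω)) hf.integrable_sq).1 h0.symm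
    filter_upwards [this] with ω hω
    exact hf0 ω (by simpa using hω)
  have pX : 0 < Var[X; P] := by
    rw [← integral_centered_sq hX]; exact hpos hx fun ω hω => by simp [hω]
  have pe : 0 < ∫ ω, regError X Y P ω ^ 2 ∂P := hpos he fun ω hω => by simp [hω]
  have pm : 0 < ∫ ω, (centered X P ω * regError X Y P ω) ^ 2 ∂P := hpos hxe2 fun ω hω => hω
  have p4 : 0 < ∫ ω, centered X P ω ^ 4 ∂P := by
    have := hpos (memLp_two_sq hx4) fun ω hω => by simp_all
    simpa only [← pow_mul] using this
  set σ := √(Var[X; P]) with hσ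
  set s := √(∫ ω, regError X Y P ω ^ 2 ∂P) with hs
  set m := √(∫ ω, (centered X P ω * regError X Y P ω) ^ 2 ∂P) with hm
  set κ := √(∫ ω, centered X P ω ^ 4 ∂P) / σ ^ 2 with hκ
  set K := (∫ ω, |centered X P ω * regError X Y P ω| ^ 3 ∂P) / m ^ 3 with hK
  have hσ0 : 0 < σ := Real.sqrt_pos.2 pX
  have hs0 : 0 < s := Real.sqrt_pos.2 pe
  have hm0 : 0 < m := Real.sqrt_pos.2 pm
  have hκ0 : 0 < κ := div_pos (Real.sqrt_pos.2 p4) (by positivity)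
  have hK0 : 0 ≤ K := div_nonneg (integral_nonneg fun ω => by positivity) (by positivity)
  have hNm : eLpNorm (centered X P * regError X Y P) 2 P = ENNReal.ofReal m := eLpNorm_two_eq hxe2
  -- transfer to the sample
  set μX := ∫ ω, X ω ∂P
  set μY := ∫ ω, Y ω ∂P
  set τ := slope X Y P
  -- One fixed measurable map sends (X, Y) to (X̃, ε) with population constants, so independence and
  -- identical distribution pass to the transformed sample.
  set φ : ℝ × ℝ → ℝ × ℝ := fun p => (p.1 - μX, p.2 - μY - τ * (p.1 - μX)) with hφ
  have hφm : Measurable φ := by fun_prop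
  have hid' : ∀ (i : Fin n) (ψ : ℝ × ℝ → ℝ), Measurable ψ → IdentDistrib
      (fun ω => ψ (Xs i ω - μX, Ys i ω - μY - τ * (Xs i ω - μX)))
      (fun ω => ψ (centered X P ω, regError X Y P ω)) P' P := fun i ψ hψ =>
    (hid i).comp (u := ψ ∘ φ) (hψ.comp hφm)
  have core := measureReal_residualMoment_le (μ := P') hn0 (K := K)
    (x := fun i ω => Xs i ω - μX) (e := fun i ω => Ys i ω - μY - τ * (Xs i ω - μX))
    (hind.comp (fun _ => φ) fun _ => hφm)
    (fun i => (hid' i Prod.fst measurable_fst).memLp_iff.2 hx4)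
    (fun i => (hid' i Prod.snd measurable_snd).memLp_iff.2 he)
    (fun i => (hid' i (fun p => p.1 * p.2) (by fun_prop)).memLp_iff.2 hxe3)
    (fun i => (hid' i Prod.fst measurable_fst).integral_eq.trans
      (integral_centered (hX.integrable one_le_two)))
    (fun i => (hid' i Prod.snd measurable_snd).integral_eq.trans (by
      have : ∫ ω, (centered Y P ω - τ * centered X P ω) ∂P = 0 := by
        rw [integral_sub (hy.integrable one_le_two) ((hx.integrable one_le_two).const_mul _),
          integral_const_mul, integral_centered (hX.integrable one_le_two),
          integral_centered (hY.integrable one_le_two)]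
        simp
      exact this))
    (fun i => (hid' i (fun p => p.1 * p.2) (by fun_prop)).integral_eq.trans
      (integral_centered_mul_regError hX hY pX.ne'))
    hσ0 hs0 hm0 hκ0
    (fun i => (hid' i (fun p => p.1 ^ 2) (by fun_prop)).integral_eq.trans (by
      rw [hσ, Real.sq_sqrt pX.le]; exact integral_centered_sq hX))
    (fun i => (hid' i (fun p => p.2 ^ 2) (by fun_prop)).integral_eq.trans
      (by rw [hs, Real.sq_sqrt pe.le]))
    (fun i => (hid' i (fun p => (p.1 * p.2) ^ 2) (by fun_prop)).integral_eq.trans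
      (by rw [hm, Real.sq_sqrt pm.le]))
    (fun i => (hid' i (fun p => p.1 ^ 4) (by fun_prop)).integral_eq.trans (by
      rw [hκ, div_mul_cancel₀ _ (by positivity), Real.sq_sqrt p4.le]))
    (fun i => (hid' i (fun p => |p.1 * p.2| ^ 3) (by fun_prop)).integral_eq.trans (by
      rw [hK, div_mul_cancel₀ _ (by positivity)])) μX μY τ
  have hset : {ω | (eLpNorm (centered X P * regError X Y P) 2 P).toReal ^ 2 / 2 ≤
        |residualMoment (fun i => Xs i ω) (fun i => Ys i ω)
          - (eLpNorm (centered X P * regError X Y P) 2 P).toReal ^ 2|} =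
      {ω | m ^ 2 / 2 ≤ |residualMoment (fun i => Xs i ω - μX + μX)
        (fun i => μY + τ * (Xs i ω - μX) + (Ys i ω - μY - τ * (Xs i ω - μX))) - m ^ 2|} := by
    rw [hNm, ENNReal.toReal_ofReal hm0.le]
    have e1 : ∀ i ω, Xs i ω - μX + μX = Xs i ω := fun i ω => by ring
    have e2 : ∀ i ω, μY + τ * (Xs i ω - μX) + (Ys i ω - μY - τ * (Xs i ω - μX)) = Ys i ω :=
      fun i ω => by ring
    simp only [e1, e2]
  rw [hset, ← ofReal_measureReal]
  refine (ENNReal.ofReal_le_ofReal core).trans ?_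
  rw [ENNReal.ofReal_div_of_pos (by positivity)]
  refine ENNReal.div_le_div_right (le_trans ?_ (three_terms_le_G1 X Y)) _
  rw [ENNReal.ofReal_add (by positivity) (by positivity),
    ENNReal.ofReal_add (by positivity) (by positivity), hNm]
  have hN3 : eLpNorm (centered X P * regError X Y P) 3 P ^ 3 = ENNReal.ofReal (K * m ^ 3) := by
    rw [hK, div_mul_cancel₀ _ (by positivity)]
    exact_mod_cast eLpNorm_pow_eq (k := 3) (by norm_num) (by exact_mod_cast hxe3)
  have hN4 : eLpNorm (centered X P) 4 P ^ 2 = ENNReal.ofReal (κ * σ ^ 2) := by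
    refine (ENNReal.pow_right_strictMono (n := 2) (by norm_num)).injective ?_
    rw [← pow_mul, eLpNorm_four_pow hx4, ← ENNReal.ofReal_pow (by positivity), hκ,
      div_mul_cancel₀ _ (by positivity), Real.sq_sqrt p4.le]
  have hsX : stdDev X P = ENNReal.ofReal σ := rfl
  gcongr
  · rw [hN3, ENNReal.ofReal_mul (by norm_num), mul_div_assoc, ← ENNReal.ofReal_pow hm0.le,
      ← ENNReal.ofReal_div_of_pos (by positivity), mul_div_cancel_right₀ _ (by positivity)]
    gcongr
    exact two_rpow_half_bound
  -- q² = σ³s²/(m²σ), where σ ≤ ‖X̃‖₃ and s ≤ σ_Y give the summand of `G1`.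
  · have hN3x : ENNReal.ofReal σ ≤ eLpNorm (centered X P) 3 P := by
      rw [← hsX, stdDev_eq_eLpNorm hX]
      exact eLpNorm_le_eLpNorm_of_exponent_le (by norm_num) hx.1
    have hsY : ENNReal.ofReal s ≤ stdDev Y P :=
      ENNReal.ofReal_le_ofReal (Real.sqrt_le_sqrt (integral_regError_sq_le hX hY pX.ne'))
    calc ENNReal.ofReal (1120 * (σ * s / m) ^ 2)
        = ENNReal.ofReal (1120 * σ ^ 3 * s ^ 2 / (m ^ 2 * σ)) := by
          congr 1; field_simp
      _ = 1120 * ENNReal.ofReal σ ^ 3 * ENNReal.ofReal s ^ 2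
            / (ENNReal.ofReal m ^ 2 * ENNReal.ofReal σ) := by
          rw [ENNReal.ofReal_div_of_pos (by positivity), ENNReal.ofReal_mul (by positivity),
            ENNReal.ofReal_mul (by norm_num), ENNReal.ofReal_mul (by positivity),
            ENNReal.ofReal_pow hσ0.le, ENNReal.ofReal_pow hs0.le, ENNReal.ofReal_pow hm0.le]
          simp
      _ ≤ _ := by rw [hsX]; gcongr
  · rw [hN4, hsX, ENNReal.ofReal_mul (by norm_num), mul_div_assoc, ← ENNReal.ofReal_pow hσ0.le,
      ← ENNReal.ofReal_div_of_pos (by positivity), mul_div_cancel_right₀ _ (by positivity)]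
    simp

end MainBound

end Slope

end

theorem mainTheorem5 :
    (∃ c₁ c₂ : ℝ≥0, Slope.RosenthalBound c₁ c₂ 4) ∧
    ∀ c₁ c₂ : ℝ≥0, Slope.RosenthalBound c₁ c₂ 4 →
    ∀ (Ω : Type*) [MeasurableSpace Ω] (P : Measure Ω) [IsProbabilityMeasure P]
      (X Y : Ω → ℝ), MemLp X 2 P → MemLp Y 2 P →
      ¬ (Slope.centered X P * Slope.regError X Y P =ᵐ[P] 0) →
      (MemLp X 6 P → MemLp Y 6 P →
        Slope.G1 X Y P < ∞ ∧ Slope.G2 c₁ X Y P < ∞ ∧ Slope.G3 c₂ X Y P < ∞) ∧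
      ∀ (Ω' : Type*) [MeasurableSpace Ω'] (P' : Measure Ω') [IsProbabilityMeasure P']
        (n : ℕ) (Xs Ys : Fin n → Ω' → ℝ), 1 ≤ n →
        iIndepFun (fun (i : Fin n) (ω : Ω') => (Xs i ω, Ys i ω)) P' →
        (∀ i, IdentDistrib (fun ω => (Xs i ω, Ys i ω)) (fun ω => (X ω, Y ω)) P' P) →
        P' {ω | (eLpNorm (Slope.centered X P * Slope.regError X Y P) 2 P).toReal ^ 2 / 2 ≤
            |Slope.residualMoment (fun i => Xs i ω) (fun i => Ys i ω)
              - (eLpNorm (Slope.centered X P * Slope.regError X Y P) 2 P).toReal ^ 2|} ≤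
          Slope.G1 X Y P / (n : ℝ≥0∞) ^ (1 / 2 : ℝ)
          + 4 * Slope.G2 c₁ X Y P / (n : ℝ≥0∞)
          + Slope.G3 c₂ X Y P / (n : ℝ≥0∞) ^ (3 / 2 : ℝ) := by
  refine ⟨⟨1, 1, Slope.rosenthalBound_one_one⟩, ?_⟩
  intro c₁ c₂ _ Ω _ P _ X Y hX hY h
  refine ⟨fun hX6 hY6 => Slope.moment_ratios_lt_top c₁ c₂ hX6 hY6 h, ?_⟩
  intro Ω' _ P' _ n Xs Ys hn hind hid
  -- The `G2` and `G3` terms only enlarge the right-hand side.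
  exact (Slope.measure_residualMoment_le_G1 hX hY h hn hind hid).trans
    (le_self_add.trans le_self_add)
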